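/- **Capacity region of the binary adder two-way relay channel.** Let $\varepsilon_R,\varepsilon_1,\varepsilon_2\in[0,1]$ and let $\mathcal H$ be the binary entropy function in bits. At time $i$ terminal 1 sends $x_{12,i}$, terminal 2 sends $x_{21,i}$ and the relay sends $x_{R,i}$ (all bits); the relay observes $y_{R,i}=x_{12,i}\oplus x_{21,i}\oplus z_{R,i}$ and terminal $a\in\{1,2\}$ observes $y_{a,i}=x_{R,i}\oplus z_{a,i}$, where all noise bits are independent and take the value $1$ with probabilities $\varepsilon_R,\varepsilon_1,\varepsilon_2$ respectively. Terminals 1 and 2 hold independent uniform messages $W_{12}$, $W_{21}$ of rates $R_{12}$, $R_{21}$ (bits per channel use). A code uses deterministic encoders $x_{ab,i}=f_{ab,i}(W_{ab},y_a^{i-1})$, a causal relay map $x_{R,i}=f_{R,i}(y_R^{i-1})$, and decoders $\hat W_{ba}=g_a(y_a^N,W_{ab})$. A pair $(R_{12},R_{21})$ of nonnegative rates is achievable if for each $\delta>0$ and all large $N$ there is a code with $N$ channel uses, rates at least $R_{12}-\delta$, $R_{21}-\delta$ and error probabilities at most $\delta$; the capacity region is the set of achievable pairs. Put $C_{12}=\min\{1-\mathcal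 H(\varepsilon_R),1-\mathcal H(\varepsilon_2)\}$ and $C_{21}=\min\{1-\mathcal H(\varepsilon_R),1-\mathcal H(\varepsilon_1)\}$. *Time-sharing scheme with fraction $\alpha\in[0,1]$ (for $R_{12}\ge R_{21}$).* A block of $n$ uses is split into a first part of length $n-\lfloor\alpha n\rfloor$, in which terminal 1 alone transmits a word of a private codebook of rate $R_{12}-R_{21}$ (terminal 2 sends zeros), and a second part of length $\lfloor\alpha n\rfloor$, in which both terminals transmit codewords of the same linear code over $GF(2)$ of rate $R_{21}$ (rates per symbol of the block). From the received block the relay detects the private index and the XOR of the two common codewords, and during the next block it sends a word of a codebook indexed by these two. Terminal 1 knows the private index, detects the XOR and removes its own part; terminal 2 detects both indices and removes its own part from the XOR. With $B$ message blocks this is a code with $(B+1)n$ channel uses. The scheme *achieves* $(R_{12},R_{21})$ if for each $\delta>0$, all large $B$ and then all large $n$, there are such codebooks and detectors for which the private codebook, the common code and both overall rates lose at most $\delta$, and the error probabilities of the relay (over all blocks), of terminal 1 and of terminal 2 are at most $\delta$. Then: 1. (Cut-set bound.) For every joint law of the inputs $(X_{12},X_{21})$ and every law of $X_R$, $\min\{I(X_{12};Y_R|X_{21}),I(X_R;Y_2)\}\le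 C_{12}$ and $\min\{I(X_{21};Y_R|X_{12}),I(X_R;Y_1)\}\le C_{21}$, with equality in both when $X_{12},X_{21},X_R$ are uniform and $X_{12},X_{21}$ are independent. 2. The capacity region is $\{(R_{12},R_{21}):0\le R_{12}\le C_{12},\ 0\le R_{21}\le C_{21}\}$. 3. If $0\le\alpha\le1$, $0\le R_{21}\le R_{12}$, $R_{12}-R_{21}\le(1-\alpha)(1-\mathcal H(\varepsilon_R))$, $R_{21}\le\alpha(1-\mathcal H(\varepsilon_R))$, $R_{21}\le1-\mathcal H(\varepsilon_1)$ and $R_{12}\le1-\mathcal H(\varepsilon_2)$, then the time-sharing scheme with fraction $\alpha$ achieves $(R_{12},R_{21})$. 4. Every point of the region in 2 is achieved by the time-sharing scheme for some $\alpha\in[0,1]$ (with the roles of the terminals exchanged when $R_{12}\le R_{21}$; either choice works when the rates are equal). 5. Let $\varepsilon_R,\varepsilon_1,\varepsilon_2\le\frac12$. The scheme achieves the corner point $(C_{12},C_{21})$ as follows (with $0/0$ read as $0$). Strong relay, $\varepsilon_R\ge\max(\varepsilon_1,\varepsilon_2)$: $C_{12}=C_{21}=1-\mathcal H(\varepsilon_R)$,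 with $\alpha=1$. Medium relay, $\varepsilon_1\ge\varepsilon_R\ge\varepsilon_2$: $C_{12}=1-\mathcal H(\varepsilon_R)$, $C_{21}=1-\mathcal H(\varepsilon_1)$, with $\alpha=\frac{1-\mathcal H(\varepsilon_1)}{1-\mathcal H(\varepsilon_R)}$. Weak relay, $\varepsilon_1\ge\varepsilon_2\ge\varepsilon_R$: $C_{12}=1-\mathcal H(\varepsilon_2)$, $C_{21}=1-\mathcal H(\varepsilon_1)$, with $\alpha=\frac{1-\mathcal H(\varepsilon_1)}{1-\mathcal H(\varepsilon_2)}$. -/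

import Mathlib

open Filter

namespace TWR

/-- The binary alphabet; addition is the modulo-2 sum. -/
abbrev Bit : Type := ZMod 2

/-! ### Information measures (in bits) -/

/-- The binary entropy function in bits. -/
noncomputable def binEntropy₂ (ε : ℝ) : ℝ := Real.binEntropy ε / Real.log 2

/-- Probability mass function of a noise bit that takes the value 1 with probability `ε`. -/
noncomputable def bern (ε : ℝ) (b : Bit) : ℝ := if b = 1 then ε else 1 - ε

/-- Shannon entropy, in bits, of a probability mass function on a finite type. -/
noncomputable def entropy {α : Type} [Fintype α] (p : α → ℝ) : ℝ :=
  (∑ a, Real.negMulLog (p a)) / Real.log 2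

/-- `I(A;B) = H(A) + H(B) - H(A,B)` for the joint mass function `p` of `(A,B)`. -/
noncomputable def mutualInfo {α β : Type} [Fintype α] [Fintype β] (p : α × β → ℝ) : ℝ :=
  entropy (fun a => ∑ b, p (a, b)) + entropy (fun b => ∑ a, p (a, b)) - entropy p

/-- `I(A;B|C) = H(A,C) + H(B,C) - H(A,B,C) - H(C)` for the joint mass function `p` of
`(A,B,C)`. -/
noncomputable def condMutualInfo {α β γ : Type} [Fintype α] [Fintype β] [Fintype γ]
    (p : α × β × γ → ℝ) : ℝ :=
  entropy (fun x : α × γ => ∑ b, p (x.1, b, x.2))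
    + entropy (fun x : β × γ => ∑ a, p (a, x.1, x.2))
    - entropy p
    - entropy (fun c : γ => ∑ a, ∑ b, p (a, b, c))

/-- Joint law of `(X₁₂, Y_R, X₂₁)` when `(X₁₂, X₂₁)` has law `p` and
`Y_R = X₁₂ ⊕ X₂₁ ⊕ Z_R`. -/
noncomputable def uplinkLaw (εR : ℝ) (p : Bit × Bit → ℝ) : Bit × Bit × Bit → ℝ :=
  fun x => p (x.1, x.2.2) * bern εR (x.2.1 - x.1 - x.2.2)

/-- Joint law of `(X_R, Y)` when `X_R` has law `q` and `Y = X_R ⊕ Z`. -/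
noncomputable def downlinkLaw (ε : ℝ) (q : Bit → ℝ) : Bit × Bit → ℝ :=
  fun x => q x.1 * bern ε (x.2 - x.1)

/-- `min {I(X₁₂;Y_R|X₂₁), I(X_R;Y₂)}`, where `p` is the law of `(X₁₂, X₂₁)` and `q` the law
of `X_R`. -/
noncomputable def cutSet₁₂ (εR ε₂ : ℝ) (p : Bit × Bit → ℝ) (q : Bit → ℝ) : ℝ :=
  min (condMutualInfo (uplinkLaw εR p)) (mutualInfo (downlinkLaw ε₂ q))

/-- `min {I(X₂₁;Y_R|X₁₂), I(X_R;Y₁)}`, where `p` is the law of `(X₁₂, X₂₁)` and `q` the law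
of `X_R`. -/
noncomputable def cutSet₂₁ (εR ε₁ : ℝ) (p : Bit × Bit → ℝ) (q : Bit → ℝ) : ℝ :=
  min (condMutualInfo (uplinkLaw εR (fun x => p (x.2, x.1)))) (mutualInfo (downlinkLaw ε₁ q))

/-! ### Codes for the binary adder two-way relay channel -/

/-- A code with `N` channel uses and message sets `W₁₂`, `W₂₁`. Terminal 1 knows the message in
`W₁₂` and observes `Y₁`, terminal 2 knows the message in `W₂₁` and observes `Y₂`. The input symbol
at time `i` (counted from 0) may depend on the `i` past observations; only times `i < N` are
used. -/
structure Code (W₁₂ W₂₁ : Type) (N : ℕ) where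
  /-- Encoder of terminal 1. -/
  enc₁₂ : (i : ℕ) → W₁₂ → (Fin i → Bit) → Bit
  /-- Encoder of terminal 2. -/
  enc₂₁ : (i : ℕ) → W₂₁ → (Fin i → Bit) → Bit
  /-- Causal transcoder of the relay. -/
  relay : (i : ℕ) → (Fin i → Bit) → Bit
  /-- Decoder of terminal 1. -/
  dec₁ : (Fin N → Bit) → W₁₂ → W₂₁
  /-- Decoder of terminal 2. -/
  dec₂ : (Fin N → Bit) → W₂₁ → W₁₂

/-- The sequences observed by the relay and by the two terminals in the first `i` channel uses. -/
structure Outputs (i : ℕ) where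
  yR : Fin i → Bit
  y₁ : Fin i → Bit
  y₂ : Fin i → Bit

namespace Code

variable {W₁₂ W₂₁ : Type} {N : ℕ}

/-- The channel outputs in the first `i` channel uses, for given messages and given noise bits
`z t = (z_R, z_1, z_2)` at time `t`. -/
def outputs (c : Code W₁₂ W₂₁ N) (w₁₂ : W₁₂) (w₂₁ : W₂₁) :
    (i : ℕ) → (Fin i → Bit × Bit × Bit) → Outputs i
  | 0, _ => ⟨Fin.elim0, Fin.elim0, Fin.elim0⟩
  | i + 1, z =>
    let o := outputs c w₁₂ w₂₁ i (Fin.init z)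
    let zi := z (Fin.last i)
    { yR := Fin.snoc (α := fun _ => Bit) o.yR
        (c.enc₁₂ i w₁₂ o.y₁ + c.enc₂₁ i w₂₁ o.y₂ + zi.1)
      y₁ := Fin.snoc (α := fun _ => Bit) o.y₁ (c.relay i o.yR + zi.2.1)
      y₂ := Fin.snoc (α := fun _ => Bit) o.y₂ (c.relay i o.yR + zi.2.2) }

open Classical in
/-- Probability of an event depending on the messages and the channel outputs, when the two
messages are independent and uniform and all noise bits are independent. -/
noncomputable def prob [Fintype W₁₂] [Fintype W₂₁] (εR ε₁ ε₂ : ℝ) (c : Code W₁₂ W₂₁ N)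
    (E : W₁₂ → W₂₁ → Outputs N → Prop) : ℝ :=
  (∑ w₁₂ : W₁₂, ∑ w₂₁ : W₂₁, ∑ z : Fin N → Bit × Bit × Bit,
      (∏ t, bern εR (z t).1 * bern ε₁ (z t).2.1 * bern ε₂ (z t).2.2)
        * (if E w₁₂ w₂₁ (c.outputs w₁₂ w₂₁ N z) then 1 else 0))
    / ((Fintype.card W₁₂ : ℝ) * (Fintype.card W₂₁ : ℝ))

/-- Error probability at terminal 1. -/
noncomputable def err₁ [Fintype W₁₂] [Fintype W₂₁] (εR ε₁ ε₂ : ℝ) (c : Code W₁₂ W₂₁ N) : ℝ :=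
  c.prob εR ε₁ ε₂ (fun w₁₂ w₂₁ o => c.dec₁ o.y₁ w₁₂ ≠ w₂₁)

/-- Error probability at terminal 2. -/
noncomputable def err₂ [Fintype W₁₂] [Fintype W₂₁] (εR ε₁ ε₂ : ℝ) (c : Code W₁₂ W₂₁ N) : ℝ :=
  c.prob εR ε₁ ε₂ (fun w₁₂ w₂₁ o => c.dec₂ o.y₂ w₂₁ ≠ w₁₂)

/-- Rate from terminal 1 to terminal 2, in bits per channel use. -/
noncomputable def rate₁₂ [Fintype W₁₂] (_c : Code W₁₂ W₂₁ N) : ℝ :=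
  Real.logb 2 (Fintype.card W₁₂) / N

/-- Rate from terminal 2 to terminal 1, in bits per channel use. -/
noncomputable def rate₂₁ [Fintype W₂₁] (_c : Code W₁₂ W₂₁ N) : ℝ :=
  Real.logb 2 (Fintype.card W₂₁) / N

end Code

/-- `(R₁₂, R₂₁)` is achievable: for each `δ > 0` and all large `N` there is a code with `N` channel
uses, rates at least `R₁₂ - δ`, `R₂₁ - δ` and error probabilities at most `δ`. -/
def Achievable (εR ε₁ ε₂ R₁₂ R₂₁ : ℝ) : Prop :=
  ∀ δ : ℝ, 0 < δ → ∀ᶠ N : ℕ in atTop,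
    ∃ M₁₂ M₂₁ : ℕ, 0 < M₁₂ ∧ 0 < M₂₁ ∧ ∃ c : Code (Fin M₁₂) (Fin M₂₁) N,
      R₁₂ - δ ≤ c.rate₁₂ ∧ R₂₁ - δ ≤ c.rate₂₁ ∧
      c.err₁ εR ε₁ ε₂ ≤ δ ∧ c.err₂ εR ε₁ ε₂ ≤ δ

/-- The capacity region: all achievable pairs of nonnegative rates `(R₁₂, R₂₁)`. -/
def capacityRegion (εR ε₁ ε₂ : ℝ) : Set (ℝ × ℝ) :=
  {R | 0 ≤ R.1 ∧ 0 ≤ R.2 ∧ Achievable εR ε₁ ε₂ R.1 R.2}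

/-! ### Time-sharing between a private codebook and a common linear code -/

/-- The ingredients of the scheme in one block of `n₁ + n₂` channel uses. In the first `n₁` uses
terminal 1 transmits alone a word of a private codebook; in the last `n₂` uses both terminals
transmit words of one linear code over GF(2), given by an injective linear encoder. The relay
detects the private index and the modulo-2 sum of the two common codewords (the encoder being
injective and linear, it is named by the sum of the two information vectors), and transmits a word
of a codebook with two indices. -/
structure TimeSharing (n₁ n₂ : ℕ) where
  /-- Size of the private codebook. -/
  K : ℕ
  K_pos : 0 < K
  /-- The private codebook. -/
  privateCode : Fin K → Fin n₁ → Bit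
  /-- Dimension of the common linear code. -/
  k : ℕ
  /-- Encoder of the common linear code. -/
  commonCode : (Fin k → Bit) →ₗ[ZMod 2] (Fin n₂ → Bit)
  commonCode_injective : Function.Injective commonCode
  /-- Relay: detection of the private index. -/
  relayPrivateDec : (Fin n₁ → Bit) → Fin K
  /-- Relay: detection of the modulo-2 sum of the common codewords. -/
  relayXorDec : (Fin n₂ → Bit) → (Fin k → Bit)
  /-- Downlink codebook of the relay. -/
  relayCode : Fin K → (Fin k → Bit) → Fin (n₁ + n₂) → Bit
  /-- Terminal 1, who knows the private index, detects the second index of the relay codeword. -/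
  dec₁ : Fin K → (Fin (n₁ + n₂) → Bit) → (Fin k → Bit)
  /-- Terminal 2 detects both indices of the relay codeword. -/
  dec₂ : (Fin (n₁ + n₂) → Bit) → Fin K × (Fin k → Bit)

/-- The symbol sent at time `t` when the consecutive blocks `x 0, …, x (B - 1)` of length `n` are
sent, followed by zeros. -/
def blockSymbol {B n : ℕ} (x : Fin B → Fin n → Bit) (t : ℕ) : Bit :=
  if h : t / n < B ∧ t % n < n then x ⟨t / n, h.1⟩ ⟨t % n, h.2⟩ else 0

/-- The `b`-th block (counted from 0) of length `n` of a sequence; missing entries are read as 0. -/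
def block {t : ℕ} (n : ℕ) (y : Fin t → Bit) (b : ℕ) : Fin n → Bit :=
  fun s => if h : b * n + s < t then y ⟨b * n + s, h⟩ else 0

namespace TimeSharing

variable {n₁ n₂ : ℕ}

/-- The pair detected by the relay from one received block. -/
def relayDec (S : TimeSharing n₁ n₂) (y : Fin (n₁ + n₂) → Bit) : Fin S.K × (Fin S.k → Bit) :=
  (S.relayPrivateDec (fun s => y (Fin.castAdd n₂ s)), S.relayXorDec (fun s => y (Fin.natAdd n₁ s)))

/-- The code with `B + 1` blocks obtained from the scheme: in the blocks `0, …, B - 1` the terminals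
send fresh messages, and during block `b + 1` the relay sends the word that corresponds to what it
has detected in block `b`. -/
def toCode (S : TimeSharing n₁ n₂) (B : ℕ) :
    Code (Fin B → Fin S.K × (Fin S.k → Bit)) (Fin B → Fin S.k → Bit) ((B + 1) * (n₁ + n₂)) where
  enc₁₂ t w _ :=
    blockSymbol (fun b => Fin.append (S.privateCode (w b).1) (S.commonCode (w b).2)) t
  enc₂₁ t v _ :=
    blockSymbol (fun b => Fin.append (fun _ : Fin n₁ => (0 : Bit)) (S.commonCode (v b))) t
  relay t y :=
    if h : 0 < t / (n₁ + n₂) ∧ t % (n₁ + n₂) < n₁ + n₂ then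
      let d := S.relayDec (block (n₁ + n₂) y (t / (n₁ + n₂) - 1))
      S.relayCode d.1 d.2 ⟨t % (n₁ + n₂), h.2⟩
    else 0
  dec₁ y w := fun b => S.dec₁ (w b).1 (block (n₁ + n₂) y (b + 1)) + (w b).2
  dec₂ y v := fun b =>
    let d := S.dec₂ (block (n₁ + n₂) y (b + 1))
    (d.1, d.2 + v b)

/-- Probability that the relay, in some block, fails to detect the private index or the modulo-2 sum
of the two common codewords. -/
noncomputable def relayErr (S : TimeSharing n₁ n₂) (B : ℕ) (εR ε₁ ε₂ : ℝ) : ℝ :=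
  (S.toCode B).prob εR ε₁ ε₂ (fun w v o =>
    ∃ b : Fin B, S.relayDec (block (n₁ + n₂) o.yR b) ≠ ((w b).1, (w b).2 + v b))

end TimeSharing

/-- The rates `R₁₂ ≥ R₂₁` are achieved by time-sharing, the common linear code being used during the
fraction `α` of each block: for each `δ > 0`, all large numbers `B` of blocks and then all large
block lengths `n` there is such a scheme, with private codebook of rate at least `R₁₂ - R₂₁ - δ` and
common code of rate at least `R₂₁ - δ` (per symbol of the block), for which the resulting code has
rates at least `R₁₂ - δ`, `R₂₁ - δ` and all error probabilities, including that of the relay, are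
at most `δ`. -/
def TimeSharingAchieves (εR ε₁ ε₂ α R₁₂ R₂₁ : ℝ) : Prop :=
  0 ≤ α ∧ α ≤ 1 ∧
  ∀ δ : ℝ, 0 < δ → ∀ᶠ B : ℕ in atTop, ∀ᶠ n : ℕ in atTop,
    ∃ S : TimeSharing (n - ⌊α * n⌋₊) ⌊α * n⌋₊,
      R₁₂ - R₂₁ - δ ≤ Real.logb 2 S.K / n ∧
      R₂₁ - δ ≤ (S.k : ℝ) / n ∧
      R₁₂ - δ ≤ (S.toCode B).rate₁₂ ∧
      R₂₁ - δ ≤ (S.toCode B).rate₂₁ ∧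
      S.relayErr B εR ε₁ ε₂ ≤ δ ∧
      (S.toCode B).err₁ εR ε₁ ε₂ ≤ δ ∧
      (S.toCode B).err₂ εR ε₁ ε₂ ≤ δ

/-- The bound `min {1 - H(ε_R), 1 - H(ε_b)}` on the rate towards terminal `b`. -/
noncomputable def rateBound (εR εb : ℝ) : ℝ := min (1 - binEntropy₂ εR) (1 - binEntropy₂ εb)

end TWR

namespace TWR

/-! ### Noise words -/

/-! Both directions rest on one fact: a Bernoulli noise word of length n has probability close to
exp(-nH), with exponentially rare exceptions in either direction (`tendsto_noiseMeas_lt`,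
`tendsto_noiseMeas_gt`).

Achievability. With a uniformly random generator matrix over GF(2), every nonzero information vector
gives a uniform codeword, so a typical noise word is moved into the typical set T with average
probability |T|/2^n per competitor (`card_filter_linearCombination_mem`). A union bound then yields
good linear codes at every rate below capacity. On the uplink, linearity makes the sum of two common
codewords a codeword that the relay can decode. On the downlink one linear code with two groups of
information bits serves both terminals: terminal 2 decodes all of it, while terminal 1 subtracts the
known private part and faces only a subcode of rate R₂₁ (`exists_timeSharing`). Blocks are chained
by `err_le`, and `timeSharingAchieves` chooses the parameters. Every point of the rectangle is
reached with α = R₂₁ / (1 - H(ε_R)) when R₂₁ ≤ R₁₂, and by exchanging the terminals otherwise.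

Converse. No entropy inequality is used; the argument counts. Fix the message of terminal 2 and all
noise except one component. When decoding succeeds, the relay output (or the output at terminal 2)
determines both the message and the remaining noise component, so at most 2^N pairs succeed. Since
noise words of probability well above 2^{-NH} are rare, more than about 2^{N(1-H)} messages force
errors (`sum_noiseProb_le_of_injOn`). Feedback through the encoders is harmless, because causality
still lets the noise be read off from the outputs.

The cut-set statement is independent of this: the two informations are output entropies minus the
noise entropy, and a binary output has at most one bit. -/

theorem sum_bit {M : Type*} [AddCommMonoid M] (f : Bit → M) : ∑ b, f b = f 0 + f 1 :=
  Fin.sum_univ_two f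

theorem bern_zero (ε : ℝ) : bern ε 0 = 1 - ε := by simp [bern]

theorem bern_one (ε : ℝ) : bern ε 1 = ε := by simp [bern]

theorem sum_bern (ε : ℝ) : ∑ b, bern ε b = 1 := by
  rw [sum_bit, bern_zero, bern_one]; ring

theorem bern_nonneg {ε : ℝ} (hε : ε ∈ Set.Icc (0 : ℝ) 1) (b : Bit) : 0 ≤ bern ε b := by
  unfold bern
  split_ifs
  · exact hε.1
  · linarith [hε.2]

/-- Probability of a noise word. -/
noncomputable def noiseProb (ε : ℝ) {n : ℕ} (z : Fin n → Bit) : ℝ := ∏ t, bern ε (z t)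

open Classical in
/-- Probability that the noise word lies in a given set. -/
noncomputable def noiseMeas (ε : ℝ) {n : ℕ} (S : Set (Fin n → Bit)) : ℝ :=
  ∑ z, if z ∈ S then noiseProb ε z else 0

theorem noiseProb_nonneg {ε : ℝ} (hε : ε ∈ Set.Icc (0 : ℝ) 1) {n : ℕ} (z : Fin n → Bit) :
    0 ≤ noiseProb ε z :=
  Finset.prod_nonneg fun _ _ => bern_nonneg hε _

theorem sum_noiseProb (ε : ℝ) (n : ℕ) : ∑ z : Fin n → Bit, noiseProb ε z = 1 := by
  have := Fintype.sum_pow (bern ε) n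
  rw [sum_bern, one_pow] at this
  exact this.symm

theorem noiseMeas_nonneg {ε : ℝ} (hε : ε ∈ Set.Icc (0 : ℝ) 1) {n : ℕ} (S : Set (Fin n → Bit)) :
    0 ≤ noiseMeas ε S :=
  Finset.sum_nonneg fun z _ => by
    split_ifs
    · exact noiseProb_nonneg hε z
    · exact le_rfl

theorem noiseMeas_union_le {ε : ℝ} (hε : ε ∈ Set.Icc (0 : ℝ) 1) {n : ℕ}
    (S T : Set (Fin n → Bit)) : noiseMeas ε (S ∪ T) ≤ noiseMeas ε S + noiseMeas ε T := by
  unfold noiseMeas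
  rw [← Finset.sum_add_distrib]
  refine Finset.sum_le_sum fun z _ => ?_
  have := noiseProb_nonneg hε z
  by_cases hS : z ∈ S <;> by_cases hT : z ∈ T <;> simp [hS, hT, this]

theorem noiseMeas_exists_le {ε : ℝ} (hε : ε ∈ Set.Icc (0 : ℝ) 1) {n B : ℕ}
    (S : Fin B → Set (Fin n → Bit)) :
    noiseMeas ε {z | ∃ b, z ∈ S b} ≤ ∑ b, noiseMeas ε (S b) := by
  classical
  unfold noiseMeas
  rw [Finset.sum_comm]
  refine Finset.sum_le_sum fun z _ => ?_
  have hz := noiseProb_nonneg hε z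
  have h0 : ∀ b ∈ Finset.univ, 0 ≤ if z ∈ S b then noiseProb ε z else 0 := fun b _ => by
    split_ifs
    · exact hz
    · exact le_rfl
  split_ifs with h
  · obtain ⟨b, hb⟩ := h
    refine le_trans ?_ (Finset.single_le_sum h0 (Finset.mem_univ b))
    simp [hb]
  · exact Finset.sum_nonneg h0

theorem noiseMeas_empty (ε : ℝ) {n : ℕ} : noiseMeas ε (∅ : Set (Fin n → Bit)) = 0 := by
  simp [noiseMeas]

theorem noiseMeas_univ (ε : ℝ) {n : ℕ} : noiseMeas ε (Set.univ : Set (Fin n → Bit)) = 1 := by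
  simp [noiseMeas, sum_noiseProb]

/-- Marginalization of a product distribution along an injective map of the coordinates. -/
theorem sum_prod_mul_comp_injective {γ : Type} [Fintype γ] (p : γ → ℝ) (hp : ∑ c, p c = 1)
    {m n : ℕ} {J : Fin m → Fin n} (hJ : Function.Injective J) (f : (Fin m → γ) → ℝ) :
    ∑ z : Fin n → γ, (∏ t, p (z t)) * f (fun s => z (J s)) = ∑ x, (∏ s, p (x s)) * f x := by
  classical
  have key : ∀ x : Fin m → γ,
      ∑ z : Fin n → γ, (∏ t, p (z t)) * (if ∀ s, x s = z (J s) then 1 else 0) =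
        ∏ s, p (x s) := by
    intro x
    -- The constraint `x s = z (J s)` as a product over all coordinates: an indicator on the range
    -- of `J` and the constant 1 elsewhere. The sum over `z` then factorizes, and coordinates off
    -- the range contribute total mass 1.
    let g : Fin n → γ → ℝ := fun t c =>
      if h : ∃ s, J s = t then (if x h.choose = c then 1 else 0) else 1
    have hg : ∀ s c, g (J s) c = if x s = c then 1 else 0 := by
      intro s c
      have h : ∃ s', J s' = J s := ⟨s, rfl⟩
      have : h.choose = s := hJ h.choose_spec
      simp only [g, dif_pos h, this]
    have h1 : ∀ z : Fin n → γ, (if ∀ s, x s = z (J s) then (1 : ℝ) else 0) = ∏ t, g t (z t) := by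
      intro z
      have : (if ∀ s, x s = z (J s) then (1 : ℝ) else 0)
          = ∏ s, if x s = z (J s) then (1 : ℝ) else 0 := by
        rw [Finset.prod_ite_zero]; simp
      rw [this]
      refine Fintype.prod_of_injective J hJ _ _ (fun t ht => ?_) fun s => (hg s _).symm
      exact dif_neg ht
    simp_rw [h1, ← Finset.prod_mul_distrib]
    rw [← Fintype.prod_sum (fun t c => p c * g t c)]
    symm
    refine Fintype.prod_of_injective J hJ _ _ (fun t ht => ?_) fun s => ?_
    · have : ∀ c, g t c = 1 := fun c => dif_neg ht
      simp [this, hp]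
    · simp [hg]
  calc ∑ z : Fin n → γ, (∏ t, p (z t)) * f (fun s => z (J s))
      = ∑ z : Fin n → γ, ∑ x : Fin m → γ,
          f x * ((∏ t, p (z t)) * (if ∀ s, x s = z (J s) then 1 else 0)) := by
        refine Finset.sum_congr rfl fun z _ => ?_
        simp_rw [← funext_iff (g := fun s => z (J s))]
        simp [mul_comm]
    _ = _ := by
        rw [Finset.sum_comm]
        refine Finset.sum_congr rfl fun x _ => ?_
        rw [← Finset.mul_sum, key, mul_comm]

theorem noiseMeas_comp_injective (ε : ℝ) {m n : ℕ} {J : Fin m → Fin n}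
    (hJ : Function.Injective J) (S : Set (Fin m → Bit)) :
    noiseMeas ε {z : Fin n → Bit | (fun s => z (J s)) ∈ S} = noiseMeas ε S := by
  classical
  have := sum_prod_mul_comp_injective (bern ε) (sum_bern ε) hJ (fun x => if x ∈ S then 1 else 0)
  simp only [mul_ite, mul_one, mul_zero] at this
  simp only [noiseMeas, noiseProb, Set.mem_ofPred_eq]
  convert this using 2

/-! ### Exponential bounds for the probability of a noise word -/

theorem sum_noiseProb_rpow {ε : ℝ} (hε : ε ∈ Set.Icc (0 : ℝ) 1) (n : ℕ) (x : ℝ) :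
    ∑ z : Fin n → Bit, noiseProb ε z ^ x = (∑ b, bern ε b ^ x) ^ n := by
  rw [Fintype.sum_pow]
  refine Finset.sum_congr rfl fun z _ => ?_
  exact (Real.finsetProd_rpow _ _ (fun t _ => bern_nonneg hε _) x).symm

/-- The case `p = 0` is included so that deterministic noise needs no separate treatment: the power
vanishes identically near `s = 0`, in agreement with `negMulLog 0 = 0`. -/
theorem hasDerivAt_rpow_one_add {p : ℝ} (hp : 0 ≤ p) :
    HasDerivAt (fun s : ℝ => p ^ (1 + s)) (-Real.negMulLog p) 0 := by
  rcases hp.eq_or_lt with rfl | hp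
  · have h : HasDerivAt (fun _ : ℝ => (0 : ℝ)) 0 0 := hasDerivAt_const 0 0
    have h2 : (fun s : ℝ => (0 : ℝ) ^ (1 + s)) =ᶠ[nhds 0] fun _ => 0 := by
      filter_upwards [lt_mem_nhds (show (-1 : ℝ) < 0 by norm_num)] with s hs
      exact Real.zero_rpow (by linarith)
    simpa using h.congr_of_eventuallyEq h2
  · have h : HasDerivAt (fun s : ℝ => 1 + s) 1 0 := (hasDerivAt_id 0).const_add 1
    have := h.const_rpow hp
    refine this.congr_deriv ?_
    simp [Real.negMulLog]; ring

theorem hasDerivAt_sum_bern_rpow {ε : ℝ} (hε : ε ∈ Set.Icc (0 : ℝ) 1) :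
    HasDerivAt (fun s : ℝ => ∑ b, bern ε b ^ (1 + s)) (-Real.binEntropy ε) 0 := by
  simp_rw [sum_bit, bern_zero, bern_one, Real.binEntropy_eq_negMulLog_add_negMulLog_one_sub]
  refine ((hasDerivAt_rpow_one_add (sub_nonneg.2 hε.2)).add
    (hasDerivAt_rpow_one_add hε.1)).congr_deriv ?_
  ring

theorem exists_pos_lt_one_of_hasDerivAt_neg {f : ℝ → ℝ} {f' : ℝ} (hf : HasDerivAt f f' 0)
    (h0 : f 0 = 1) (hf' : f' < 0) : ∃ s, 0 < s ∧ f s < 1 := by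
  have h1 := hasDerivAt_iff_tendsto_slope.1 hf
  have h2 : Tendsto (slope f 0) (nhdsWithin 0 (Set.Ioi 0)) (nhds f') :=
    h1.mono_left (nhdsWithin_mono _ fun x hx => ne_of_gt hx)
  obtain ⟨s, hs, hs0⟩ := ((h2.eventually (gt_mem_nhds hf')).and self_mem_nhdsWithin).exists
  refine ⟨s, hs0, ?_⟩
  have hs0' : (0 : ℝ) < s := hs0
  rw [slope_def_field, h0, sub_zero, div_neg_iff] at hs
  rcases hs with hs | hs <;> linarith [hs.1, hs.2]

/-- The base of a Chernoff bound. As a function of `s` it equals 1 at 0 and has derivative `-η`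
there, the entropy terms cancelling, so it drops below 1 for some small `s`. The signs `σ = -1` and
`σ = 1` serve the lower and upper tails of the word probability. -/
theorem exists_pos_sum_bern_rpow_lt {ε : ℝ} (hε : ε ∈ Set.Icc (0 : ℝ) 1) {η : ℝ} (hη : 0 < η)
    (σ : ℝ) : ∃ s, 0 < s ∧
      (∑ b, bern ε b ^ (1 + σ * s)) * Real.exp (s * (σ * Real.binEntropy ε - η)) < 1 := by
  refine exists_pos_lt_one_of_hasDerivAt_neg (f' := -η) ?_ ?_ (by linarith)
  · have h1 : HasDerivAt (fun s : ℝ => ∑ b, bern ε b ^ (1 + σ * s))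
        (-Real.binEntropy ε * σ) 0 := by
      have hl : HasDerivAt (fun s : ℝ => σ * s) σ 0 := by
        simpa using (hasDerivAt_id (0 : ℝ)).const_mul σ
      have h0 := hasDerivAt_sum_bern_rpow hε
      rw [← mul_zero σ] at h0
      exact h0.comp (0 : ℝ) hl
    have h2 : HasDerivAt (fun s : ℝ => Real.exp (s * (σ * Real.binEntropy ε - η)))
        (σ * Real.binEntropy ε - η) 0 := by
      have := ((hasDerivAt_id (0 : ℝ)).mul_const (σ * Real.binEntropy ε - η)).exp
      simpa using this
    refine (h1.mul h2).congr_deriv ?_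
    simp [sum_bern]
    ring
  · simp [sum_bern]

/-- Chernoff's method: the pointwise bound may be summed over all words, and that sum is the n-th
power of a one-letter sum. -/
theorem noiseMeas_le_of_le_rpow {ε : ℝ} (hε : ε ∈ Set.Icc (0 : ℝ) 1) {n : ℕ}
    {S : Set (Fin n → Bit)} {x r : ℝ}
    (h : ∀ z ∈ S, noiseProb ε z ≤ noiseProb ε z ^ x * Real.exp r ^ n) :
    noiseMeas ε S ≤ ((∑ b, bern ε b ^ x) * Real.exp r) ^ n := by
  rw [mul_pow, ← sum_noiseProb_rpow hε, Finset.sum_mul]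
  refine Finset.sum_le_sum fun z _ => ?_
  split_ifs with hz
  · exact h z hz
  · exact mul_nonneg (Real.rpow_nonneg (noiseProb_nonneg hε z) _) (pow_nonneg (Real.exp_pos _).le _)

/-- A noise word rarely has a probability below `exp (-n (H + η))`. -/
theorem tendsto_noiseMeas_lt {ε : ℝ} (hε : ε ∈ Set.Icc (0 : ℝ) 1) {η : ℝ} (hη : 0 < η) :
    Tendsto (fun n : ℕ => noiseMeas ε
      {z : Fin n → Bit | noiseProb ε z < Real.exp (-(n * (Real.binEntropy ε + η)))})
      atTop (nhds 0) := by
  obtain ⟨s, hs, hlt⟩ := exists_pos_sum_bern_rpow_lt hε hη (-1)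
  refine squeeze_zero (fun n => noiseMeas_nonneg hε _)
    (fun n => noiseMeas_le_of_le_rpow hε (x := 1 + -1 * s)
      (r := s * (-1 * Real.binEntropy ε - η)) (fun z hz => ?_))
    (tendsto_pow_atTop_nhds_zero_of_lt_one (mul_nonneg (Finset.sum_nonneg fun b _ =>
      Real.rpow_nonneg (bern_nonneg hε b) _) (Real.exp_pos _).le) hlt)
  rcases (noiseProb_nonneg hε z).eq_or_lt with h0 | h0
  · rw [← h0]
    exact mul_nonneg (Real.rpow_nonneg le_rfl _) (pow_nonneg (Real.exp_pos _).le _)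
  · have h1 : noiseProb ε z = noiseProb ε z ^ (1 + -1 * s) * noiseProb ε z ^ s := by
      rw [← Real.rpow_add h0]; simp
    conv_lhs => rw [h1]
    refine mul_le_mul_of_nonneg_left ?_ (Real.rpow_nonneg h0.le _)
    refine (Real.rpow_le_rpow h0.le (le_of_lt hz) hs.le).trans ?_
    rw [← Real.exp_mul, ← Real.exp_nat_mul]
    apply le_of_eq; congr 1; ring

/-- A noise word rarely has a probability above `exp (-n (H - η))`. -/
theorem tendsto_noiseMeas_gt {ε : ℝ} (hε : ε ∈ Set.Icc (0 : ℝ) 1) {η : ℝ} (hη : 0 < η) :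
    Tendsto (fun n : ℕ => noiseMeas ε
      {z : Fin n → Bit | Real.exp (-(n * (Real.binEntropy ε - η))) < noiseProb ε z})
      atTop (nhds 0) := by
  obtain ⟨s, hs, hlt⟩ := exists_pos_sum_bern_rpow_lt hε hη 1
  refine squeeze_zero (fun n => noiseMeas_nonneg hε _)
    (fun n => noiseMeas_le_of_le_rpow hε (x := 1 + 1 * s)
      (r := s * (1 * Real.binEntropy ε - η)) (fun z hz => ?_))
    (tendsto_pow_atTop_nhds_zero_of_lt_one (mul_nonneg (Finset.sum_nonneg fun b _ =>
      Real.rpow_nonneg (bern_nonneg hε b) _) (Real.exp_pos _).le) hlt)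
  have h0 : 0 < noiseProb ε z := (Real.exp_pos _).trans hz
  rw [one_mul, Real.rpow_add h0, Real.rpow_one, mul_assoc]
  refine le_mul_of_one_le_right h0.le ?_
  have h2 := Real.rpow_le_rpow (Real.exp_pos _).le (le_of_lt hz) hs.le
  rw [← Real.exp_mul] at h2
  calc (1 : ℝ) = Real.exp (-(n * (Real.binEntropy ε - η)) * s) *
      Real.exp (s * (1 * Real.binEntropy ε - η)) ^ n := by
        rw [← Real.exp_nat_mul, ← Real.exp_add, eq_comm, Real.exp_eq_one_iff]; ring
    _ ≤ _ := mul_le_mul_of_nonneg_right h2 (pow_nonneg (Real.exp_pos _).le _)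

theorem card_mul_le_one {ε : ℝ} (hε : ε ∈ Set.Icc (0 : ℝ) 1) {n : ℕ} {a : ℝ}
    (T : Finset (Fin n → Bit)) (h : ∀ z ∈ T, a ≤ noiseProb ε z) : (T.card : ℝ) * a ≤ 1 := by
  rw [← sum_noiseProb ε n, ← nsmul_eq_mul]
  exact (Finset.card_nsmul_le_sum _ _ _ h).trans
    (Finset.sum_le_sum_of_subset_of_nonneg (Finset.subset_univ _)
      fun z _ _ => noiseProb_nonneg hε z)

/-! ### Random linear codes -/

section LinearCode

variable {ι : Type} [Fintype ι] {n : ℕ}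

/-- For fixed `d ≠ 0` the map from generator matrices to codewords is a surjective group
homomorphism, so its fibres have equal size: the codeword is uniform, and so is its translate by
`z`. -/
theorem card_filter_linearCombination_mem [DecidableEq ι] {d : ι → Bit} (hd : d ≠ 0)
    (z : Fin n → Bit) (T : Finset (Fin n → Bit)) :
    ((Finset.univ.filter fun a : ι → Fin n → Bit =>
      z + Fintype.linearCombination Bit a d ∈ T).card : ℝ) =
      Fintype.card (ι → Fin n → Bit) * (T.card / 2 ^ n) := by
  let φ : (ι → Fin n → Bit) →+ (Fin n → Bit) :=
    { toFun := fun a => Fintype.linearCombination Bit a d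
      map_zero' := by simp [Fintype.linearCombination_apply]
      map_add' := fun a b => by
        simp [Fintype.linearCombination_apply, smul_add, Finset.sum_add_distrib] }
  have hφ : ∀ v, v ∈ Set.range φ := by
    intro v
    obtain ⟨j, hj⟩ := Function.ne_iff.1 hd
    refine ⟨Pi.single j ((d j)⁻¹ • v), ?_⟩
    change Fintype.linearCombination Bit _ d = v
    rw [Fintype.linearCombination_apply, Finset.sum_eq_single j]
    · simp [smul_smul, mul_inv_cancel₀ hj]
    · intro i _ hi; simp [hi]
    · simp
  set c : ℕ := (Finset.univ.filter fun a => φ a = 0).card with hc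
  have hfib : ∀ v, (Finset.univ.filter fun a => φ a = v).card = c := fun v =>
    AddMonoidHom.card_fiber_eq_of_mem_range φ (hφ v) (hφ 0)
  have hcount : ∀ S : Finset (Fin n → Bit),
      (Finset.univ.filter fun a => φ a ∈ S).card = S.card * c := by
    intro S
    rw [Finset.card_eq_sum_card_fiberwise (f := φ) (t := S) (fun a ha => by simpa using ha)]
    rw [← smul_eq_mul, ← Finset.sum_const]
    refine Finset.sum_congr rfl fun v hv => ?_
    rw [← hfib v]
    congr 1
    ext a
    simp only [Finset.mem_filter, Finset.mem_univ, true_and]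
    exact ⟨fun h => h.2, fun h => ⟨h ▸ hv, h⟩⟩
  have h1 : Fintype.card (ι → Fin n → Bit) = 2 ^ n * c := by
    have := hcount Finset.univ
    simpa using this
  have h2 : (Finset.univ.filter fun a : ι → Fin n → Bit =>
      z + Fintype.linearCombination Bit a d ∈ T).card = T.card * c := by
    have := hcount (T.map (Equiv.addLeft (-z)).toEmbedding)
    rw [Finset.card_map] at this
    rw [← this]
    congr 1
    ext a
    simp only [Finset.mem_filter, Finset.mem_univ, true_and, Finset.mem_map,
      Equiv.coe_toEmbedding, Equiv.coe_addLeft]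
    constructor
    · intro h; exact ⟨_, h, by rw [neg_add_cancel_left]; rfl⟩
    · rintro ⟨t, ht, h⟩
      have : z + Fintype.linearCombination Bit a d = t := by
        change -z + t = Fintype.linearCombination Bit a d at h
        rw [← h, add_neg_cancel_left]
      rwa [this]
  rw [h2, h1]
  push_cast
  field_simp

/-- The noise words that are not in `T`, or are moved into `T` by a codeword with information
vector in `D`. -/
def badNoise (T : Finset (Fin n → Bit)) (D : Finset (ι → Bit)) (a : ι → Fin n → Bit) :
    Set (Fin n → Bit) :=
  {z | z ∉ T ∨ ∃ d ∈ D, z + Fintype.linearCombination Bit a d ∈ T}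

/-- The first-moment bound of random coding: a union bound over `D`, then an average over all
generator matrices, under which each nonzero `d` costs `T.card / 2 ^ n`. -/
theorem sum_noiseMeas_badNoise_le [DecidableEq ι] {ε : ℝ} (hε : ε ∈ Set.Icc (0 : ℝ) 1)
    (T : Finset (Fin n → Bit)) (D : Finset (ι → Bit)) (hD : (0 : ι → Bit) ∉ D) :
    ∑ a : ι → Fin n → Bit, noiseMeas ε (badNoise T D a) ≤
      ∑ _a : ι → Fin n → Bit, (noiseMeas ε ((T : Set (Fin n → Bit))ᶜ) + D.card * T.card / 2 ^ n) := by
  classical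
  have h1 : ∀ a : ι → Fin n → Bit, noiseMeas ε (badNoise T D a) ≤
      noiseMeas ε ((T : Set (Fin n → Bit))ᶜ) + ∑ z, ∑ d ∈ D, noiseProb ε z *
        if z + Fintype.linearCombination Bit a d ∈ T then 1 else 0 := by
    intro a
    unfold noiseMeas
    rw [← Finset.sum_add_distrib]
    refine Finset.sum_le_sum fun z _ => ?_
    have hz := noiseProb_nonneg hε z
    have h0 : ∀ d ∈ D, 0 ≤ noiseProb ε z *
        if z + Fintype.linearCombination Bit a d ∈ T then (1 : ℝ) else 0 := fun d _ => by
      split_ifs <;> simp [hz]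
    by_cases hT : z ∈ T
    · by_cases hb : z ∈ badNoise T D a
      · rw [if_pos hb]
        rcases hb with hb | ⟨d, hd, hb⟩
        · exact absurd hT hb
        · have := Finset.single_le_sum h0 hd
          simpa [hT, hb] using this
      · rw [if_neg hb]
        exact add_nonneg (by simp [hT]) (Finset.sum_nonneg h0)
    · rw [if_pos (show z ∈ ((T : Set (Fin n → Bit))ᶜ) by simpa using hT)]
      refine le_add_of_le_of_nonneg ?_ (Finset.sum_nonneg h0)
      split_ifs <;> simp [hz]
  refine (Finset.sum_le_sum fun a _ => h1 a).trans ?_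
  rw [Finset.sum_add_distrib, Finset.sum_add_distrib]
  refine add_le_add le_rfl (le_of_eq ?_)
  rw [Finset.sum_comm]
  calc ∑ z, ∑ a : ι → Fin n → Bit, ∑ d ∈ D, noiseProb ε z *
        (if z + Fintype.linearCombination Bit a d ∈ T then (1 : ℝ) else 0)
      = ∑ z, ∑ d ∈ D, noiseProb ε z *
          (Fintype.card (ι → Fin n → Bit) * (T.card / 2 ^ n)) := by
        refine Finset.sum_congr rfl fun z _ => ?_
        rw [Finset.sum_comm]
        refine Finset.sum_congr rfl fun d hd => ?_
        rw [← card_filter_linearCombination_mem (ne_of_mem_of_not_mem hd hD) z T,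
          ← Finset.mul_sum, Finset.sum_boole]
    _ = _ := by
        simp_rw [← Finset.mul_sum]
        simp_rw [Finset.sum_const, ← Finset.sum_mul, sum_noiseProb, nsmul_eq_mul,
          Finset.card_univ]
        ring

/-- A linear code that is good for two noise levels and two sets of information vectors. -/
theorem exists_noiseMeas_badNoise_le [DecidableEq ι] {ε ε' : ℝ} (hε : ε ∈ Set.Icc (0 : ℝ) 1)
    (hε' : ε' ∈ Set.Icc (0 : ℝ) 1) (T T' : Finset (Fin n → Bit)) (D D' : Finset (ι → Bit))
    (hD : (0 : ι → Bit) ∉ D) (hD' : (0 : ι → Bit) ∉ D') {η : ℝ}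
    (hT : noiseMeas ε ((T : Set (Fin n → Bit))ᶜ) ≤ η)
    (hTD : (D.card : ℝ) * T.card ≤ η * 2 ^ n)
    (hT' : noiseMeas ε' ((T' : Set (Fin n → Bit))ᶜ) ≤ η)
    (hTD' : (D'.card : ℝ) * T'.card ≤ η * 2 ^ n) :
    ∃ a : ι → Fin n → Bit, noiseMeas ε (badNoise T D a) ≤ 4 * η ∧
      noiseMeas ε' (badNoise T' D' a) ≤ 4 * η := by
  have h := add_le_add (sum_noiseMeas_badNoise_le hε T D hD)
    (sum_noiseMeas_badNoise_le hε' T' D' hD')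
  rw [← Finset.sum_add_distrib, ← Finset.sum_add_distrib] at h
  -- The two measures are averaged jointly. Their sum is at most `4 * η` for some matrix, hence so
  -- is each of them for the same matrix.
  obtain ⟨a, -, ha⟩ := Finset.exists_le_of_sum_le Finset.univ_nonempty h
  have h2 : (0 : ℝ) < 2 ^ n := by positivity
  have e1 := (div_le_iff₀ h2).2 hTD
  have e2 := (div_le_iff₀ h2).2 hTD'
  have p1 := noiseMeas_nonneg hε (badNoise T D a)
  have p2 := noiseMeas_nonneg hε' (badNoise T' D' a)
  exact ⟨a, by linarith, by linarith⟩

end LinearCode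

/-- Decode to any message whose residual lies in `T`. A wrong choice `m'` would put `z + L (m - m')`
in `T`, which the hypothesis on nonzero `d` excludes. -/
theorem exists_decoder {V : Type} [AddCommGroup V] {n : ℕ}
    (L : V →+ (Fin n → Bit)) (T : Finset (Fin n → Bit)) :
    ∃ dec : (Fin n → Bit) → V, ∀ z m, z ∈ T → (∀ d ≠ 0, z + L d ∉ T) → dec (L m + z) = m := by
  classical
  refine ⟨fun y => if h : ∃ m, y - L m ∈ T then h.choose else 0, fun z m hz hd => ?_⟩
  have h : ∃ m', L m + z - L m' ∈ T := ⟨m, by simpa using hz⟩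
  simp only [dif_pos h]
  by_contra hne
  refine hd (m - h.choose) (sub_ne_zero.2 (Ne.symm hne)) ?_
  have := h.choose_spec
  rwa [map_sub, ← add_sub_assoc, add_comm z]

/-! ### Sizes of typical sets compared with code rates. -/

theorem log_two_mul_one_sub_binEntropy₂ (ε : ℝ) :
    Real.log 2 * (1 - binEntropy₂ ε) = Real.log 2 - Real.binEntropy ε := by
  have : Real.log 2 ≠ 0 := (Real.log_pos one_lt_two).ne'
  unfold binEntropy₂
  field_simp

/-- Typical sets that are small enough for random codes of a rate below `β (1 - H(ε))`. -/
theorem exists_typicalSet {ε : ℝ} (hε : ε ∈ Set.Icc (0 : ℝ) 1) {N : ℕ → ℕ} {β R δ η : ℝ}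
    (hN : Tendsto (fun n : ℕ => (N n : ℝ) / n) atTop (nhds β)) (hβ0 : 0 ≤ β) (hβ1 : β ≤ 1)
    (hR : R ≤ β * (1 - binEntropy₂ ε)) (hδ : 0 < δ) (hη : 0 < η) :
    ∀ᶠ n : ℕ in atTop, ∀ k : ℕ, (k : ℝ) ≤ max 0 (n * (R - δ)) →
      ∃ T : Finset (Fin (N n) → Bit), noiseMeas ε ((T : Set (Fin (N n) → Bit))ᶜ) ≤ η ∧
        ((2 : ℝ) ^ k - 1) * T.card ≤ η * 2 ^ N n := by
  classical
  -- For `R ≤ δ` only `k = 0` is allowed, so there is no competing codeword and the whole space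
  -- serves as `T`. This also disposes of `β = 0`, where `N n` need not tend to infinity.
  rcases le_or_gt R δ with hRδ | hRδ
  · refine Eventually.of_forall fun n k hk => ⟨Finset.univ, ?_, ?_⟩
    · simpa [noiseMeas_empty] using hη.le
    · rw [max_eq_left (mul_nonpos_of_nonneg_of_nonpos n.cast_nonneg (by linarith))] at hk
      have : k = 0 := by exact_mod_cast le_antisymm hk k.cast_nonneg
      subst this
      simp only [pow_zero, sub_self, zero_mul]
      positivity
  have hβ : 0 < β := by
    rcases hβ0.eq_or_lt with h | h
    · rw [← h] at hR; linarith
    · exact h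
  have hl2 : 0 < Real.log 2 := Real.log_pos one_lt_two
  have hNtop : Tendsto N atTop atTop := by
    have h1 : Tendsto (fun n : ℕ => (N n : ℝ) / n * n) atTop atTop :=
      hN.pos_mul_atTop hβ tendsto_natCast_atTop_atTop
    refine tendsto_natCast_atTop_iff.1 (h1.congr' ?_)
    filter_upwards [eventually_ne_atTop 0] with n hn
    field_simp
  -- Half of the rate margin `δ * log 2` is spent on the typical set; the other half keeps the
  -- exponent in `hlim` negative.
  set η' : ℝ := δ * Real.log 2 / 2 with hη'
  have hη'0 : 0 < η' := by positivity
  have htail := ((tendsto_noiseMeas_lt hε hη'0).comp hNtop).eventually (gt_mem_nhds hη)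
  have hlim : Tendsto (fun n : ℕ => ((R - δ) * Real.log 2 +
      (N n : ℝ) / n * (Real.binEntropy ε + η' - Real.log 2)) * n) atTop atBot := by
    refine Tendsto.neg_mul_atTop (C := (R - δ) * Real.log 2 +
      β * (Real.binEntropy ε + η' - Real.log 2)) ?_ ?_ tendsto_natCast_atTop_atTop
    · have h1 := mul_le_mul_of_nonneg_left hR hl2.le
      have h2 : Real.log 2 * (β * (1 - binEntropy₂ ε)) =
          β * (Real.log 2 - Real.binEntropy ε) := by
        rw [← log_two_mul_one_sub_binEntropy₂]; ring
      rw [h2] at h1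
      have h3 : β * η' ≤ η' := mul_le_of_le_one_left hη'0.le hβ1
      have h4 : 0 < δ * Real.log 2 := by positivity
      nlinarith
    · exact tendsto_const_nhds.add (hN.mul_const _)
  filter_upwards [htail, hlim.eventually_le_atBot (Real.log η), eventually_gt_atTop 0]
    with n hn1 hn2 hn0 k hk
  have hn0' : (0 : ℝ) < n := by exact_mod_cast hn0
  rw [max_eq_right (mul_nonneg hn0'.le (by linarith))] at hk
  set a : ℝ := Real.exp (-(N n * (Real.binEntropy ε + η'))) with ha
  set T : Finset (Fin (N n) → Bit) := Finset.univ.filter fun z => a ≤ noiseProb ε z with hT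
  refine ⟨T, ?_, ?_⟩
  · refine le_trans (le_of_eq ?_) (le_of_lt hn1)
    simp only [Function.comp]
    congr 1
    ext z
    simp [hT, ha]
  · have hcard : (T.card : ℝ) * a ≤ 1 := card_mul_le_one hε T fun z hz => by
      simpa [hT] using hz
    have hcard' : (T.card : ℝ) ≤ Real.exp (N n * (Real.binEntropy ε + η')) := by
      rw [ha, Real.exp_neg, ← div_eq_mul_inv, div_le_one (Real.exp_pos _)] at hcard
      exact hcard
    have hpow : ∀ m : ℕ, (2 : ℝ) ^ m = Real.exp (m * Real.log 2) := fun m => by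
      rw [Real.exp_nat_mul, Real.exp_log two_pos]
    calc ((2 : ℝ) ^ k - 1) * T.card
        ≤ 2 ^ k * Real.exp (N n * (Real.binEntropy ε + η')) :=
          mul_le_mul (by linarith) hcard' (by positivity) (by positivity)
      _ ≤ Real.exp (Real.log η) * 2 ^ N n := by
          rw [hpow, hpow, ← Real.exp_add, ← Real.exp_add, Real.exp_le_exp]
          have e1 : ((R - δ) * Real.log 2 +
              (N n : ℝ) / n * (Real.binEntropy ε + η' - Real.log 2)) * n =
              n * (R - δ) * Real.log 2 + N n * (Real.binEntropy ε + η' - Real.log 2) := by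
            field_simp
          rw [e1] at hn2
          have := mul_le_mul_of_nonneg_right hk hl2.le
          nlinarith
      _ = _ := by rw [Real.exp_log hη]

/-! ### Channel outputs and probabilities of a code -/

/-- The first `i` of the `j` observed symbols. -/
def Outputs.restrict {i j : ℕ} (h : i ≤ j) (o : Outputs j) : Outputs i where
  yR s := o.yR (Fin.castLE h s)
  y₁ s := o.y₁ (Fin.castLE h s)
  y₂ s := o.y₂ (Fin.castLE h s)

/-- Noise sequence with given components. -/
def zipNoise {N : ℕ} (a b c : Fin N → Bit) : Fin N → Bit × Bit × Bit := fun t => (a t, b t, c t)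

/-- The components of a noise sequence. -/
def noiseEquiv (N : ℕ) :
    (Fin N → Bit × Bit × Bit) ≃ (Fin N → Bit) × (Fin N → Bit) × (Fin N → Bit) where
  toFun z := (fun t => (z t).1, fun t => (z t).2.1, fun t => (z t).2.2)
  invFun x := zipNoise x.1 x.2.1 x.2.2
  left_inv _ := rfl
  right_inv _ := rfl

theorem sum_noise_eq {N : ℕ} (εR ε₁ ε₂ : ℝ) (f : (Fin N → Bit × Bit × Bit) → ℝ) :
    ∑ z : Fin N → Bit × Bit × Bit,
      (∏ t, bern εR (z t).1 * bern ε₁ (z t).2.1 * bern ε₂ (z t).2.2) * f z =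
    ∑ a, ∑ b, ∑ c, noiseProb εR a * noiseProb ε₁ b * noiseProb ε₂ c * f (zipNoise a b c) := by
  rw [← (noiseEquiv N).symm.sum_comp, Fintype.sum_prod_type]
  refine Finset.sum_congr rfl fun a _ => ?_
  rw [Fintype.sum_prod_type]
  refine Finset.sum_congr rfl fun b _ => Finset.sum_congr rfl fun c _ => ?_
  rw [Finset.prod_mul_distrib, Finset.prod_mul_distrib]
  rfl

namespace Code

variable {W V : Type} {N : ℕ}

theorem outputs_restrict (c : Code W V N) (w : W) (v : V) {i j : ℕ} (h : i ≤ j)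
    (z : Fin j → Bit × Bit × Bit) :
    c.outputs w v i (fun s => z (Fin.castLE h s)) = (c.outputs w v j z).restrict h := by
  induction j with
  | zero =>
    obtain rfl : i = 0 := by omega
    rfl
  | succ j ih =>
    rcases h.eq_or_lt with rfl | hlt
    · rfl
    · have h' : i ≤ j := by omega
      have key : ∀ (x : Fin j → Bit) (y : Bit) (s : Fin i),
          Fin.snoc (α := fun _ => Bit) x y (Fin.castLE h s) = x (Fin.castLE h' s) := fun x y s =>
        Fin.snoc_castSucc (α := fun _ => Bit) y x (Fin.castLE h' s)
      rw [show (fun s => z (Fin.castLE h s)) = fun s => Fin.init z (Fin.castLE h' s) from rfl,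
        ih h']
      simp only [Outputs.restrict, outputs, key]

theorem outputs_succ_last (c : Code W V N) (w : W) (v : V) (i : ℕ)
    (z : Fin (i + 1) → Bit × Bit × Bit) :
    let o := c.outputs w v i (Fin.init z)
    (c.outputs w v (i + 1) z).yR (Fin.last i) =
        c.enc₁₂ i w o.y₁ + c.enc₂₁ i v o.y₂ + (z (Fin.last i)).1 ∧
      (c.outputs w v (i + 1) z).y₁ (Fin.last i) = c.relay i o.yR + (z (Fin.last i)).2.1 ∧
      (c.outputs w v (i + 1) z).y₂ (Fin.last i) = c.relay i o.yR + (z (Fin.last i)).2.2 := by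
  simp [outputs]

/-- The channel equations at a single time within the full output, in place of the recursion; the
later block and converse arguments use this form. -/
theorem outputs_apply (c : Code W V N) (w : W) (v : V) {n : ℕ}
    (z : Fin n → Bit × Bit × Bit) (t : Fin n) :
    let o := (c.outputs w v n z).restrict t.2.le
    (c.outputs w v n z).yR t = c.enc₁₂ t w o.y₁ + c.enc₂₁ t v o.y₂ + (z t).1 ∧
      (c.outputs w v n z).y₁ t = c.relay t o.yR + (z t).2.1 ∧
      (c.outputs w v n z).y₂ t = c.relay t o.yR + (z t).2.2 := by
  have h1 := c.outputs_restrict w v (Nat.succ_le_of_lt t.2) z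
  have h2 := c.outputs_restrict w v t.2.le z
  have h3 := c.outputs_succ_last w v t (fun s => z (Fin.castLE t.2 s))
  rw [h1] at h3
  have h4 : Fin.init (fun s => z (Fin.castLE (Nat.succ_le_of_lt t.2) s)) =
      fun s => z (Fin.castLE t.2.le s) := rfl
  rw [h4, h2] at h3
  exact h3

theorem outputs_congr_enc {N' : ℕ} {W' V' : Type} (c : Code W V N) (c' : Code W' V' N')
    (w : W) (v : V) (w' : W') (v' : V') (h12 : ∀ i y, c.enc₁₂ i w y = c'.enc₁₂ i w' y)
    (h21 : ∀ i y, c.enc₂₁ i v y = c'.enc₂₁ i v' y) (hr : ∀ i y, c.relay i y = c'.relay i y)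
    (i : ℕ) (z : Fin i → Bit × Bit × Bit) : c.outputs w v i z = c'.outputs w' v' i z := by
  induction i with
  | zero => rfl
  | succ i ih => simp only [outputs, ih, h12, h21, hr]

/-- The code with the roles of the terminals exchanged. -/
def swap (c : Code W V N) : Code V W N where
  enc₁₂ := c.enc₂₁
  enc₂₁ := c.enc₁₂
  relay := c.relay
  dec₁ := c.dec₂
  dec₂ := c.dec₁

theorem swap_outputs (c : Code W V N) (w : W) (v : V) (i : ℕ) (a b d : Fin i → Bit) :
    c.swap.outputs v w i (zipNoise a d b) =
      ⟨(c.outputs w v i (zipNoise a b d)).yR, (c.outputs w v i (zipNoise a b d)).y₂,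
        (c.outputs w v i (zipNoise a b d)).y₁⟩ := by
  induction i with
  | zero => rfl
  | succ i ih =>
    have h : ∀ x y z : Fin (i + 1) → Bit,
        Fin.init (zipNoise x y z) = zipNoise (Fin.init x) (Fin.init y) (Fin.init z) :=
      fun _ _ _ => rfl
    simp only [outputs, h, ih (Fin.init a) (Fin.init b) (Fin.init d)]
    simp only [swap, zipNoise, add_comm (c.enc₁₂ i w _)]

/-- A code used in a longer block, with renamed messages. -/
def extend {W' V' : Type} {N' : ℕ} (c : Code W V N) (h : N ≤ N') (e : W ≃ W') (f : V ≃ V') :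
    Code W' V' N' where
  enc₁₂ i w := c.enc₁₂ i (e.symm w)
  enc₂₁ i v := c.enc₂₁ i (f.symm v)
  relay := c.relay
  dec₁ y w := f (c.dec₁ (fun s => y (Fin.castLE h s)) (e.symm w))
  dec₂ y v := e (c.dec₂ (fun s => y (Fin.castLE h s)) (f.symm v))

variable [Fintype W] [Fintype V]

theorem prob_eq (εR ε₁ ε₂ : ℝ) (c : Code W V N) (E : W → V → Outputs N → Prop)
    [∀ w v o, Decidable (E w v o)] :
    c.prob εR ε₁ ε₂ E = (∑ w, ∑ v, ∑ zR, ∑ z₁, ∑ z₂,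
      noiseProb εR zR * noiseProb ε₁ z₁ * noiseProb ε₂ z₂ *
        (if E w v (c.outputs w v N (zipNoise zR z₁ z₂)) then 1 else 0)) /
      ((Fintype.card W : ℝ) * (Fintype.card V : ℝ)) := by
  unfold prob
  congr 1
  refine Finset.sum_congr rfl fun w _ => Finset.sum_congr rfl fun v _ => ?_
  rw [sum_noise_eq εR ε₁ ε₂]
  refine Finset.sum_congr rfl fun a _ => Finset.sum_congr rfl fun b _ =>
    Finset.sum_congr rfl fun c _ => ?_
  congr

theorem sum_noiseProb_mul_three (εR ε₁ ε₂ : ℝ) (f g h : (Fin N → Bit) → ℝ) :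
    ∑ a : Fin N → Bit, ∑ b : Fin N → Bit, ∑ c : Fin N → Bit,
      (noiseProb εR a * f a) * (noiseProb ε₁ b * g b) * (noiseProb ε₂ c * h c) =
    (∑ a, noiseProb εR a * f a) * (∑ b, noiseProb ε₁ b * g b) * ∑ c, noiseProb ε₂ c * h c := by
  simp_rw [← Finset.mul_sum, ← Finset.sum_mul, ← Finset.mul_sum, ← Finset.sum_mul]

/-- A union bound for an event that requires exceptional noise. -/
theorem prob_le {εR ε₁ ε₂ : ℝ} (hR : εR ∈ Set.Icc (0 : ℝ) 1) (h₁ : ε₁ ∈ Set.Icc (0 : ℝ) 1)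
    (h₂ : ε₂ ∈ Set.Icc (0 : ℝ) 1) (c : Code W V N) (E : W → V → Outputs N → Prop)
    (SR S₁ S₂ : Set (Fin N → Bit))
    (h : ∀ w v zR z₁ z₂, E w v (c.outputs w v N (zipNoise zR z₁ z₂)) →
      zR ∈ SR ∨ z₁ ∈ S₁ ∨ z₂ ∈ S₂) :
    c.prob εR ε₁ ε₂ E ≤ noiseMeas εR SR + noiseMeas ε₁ S₁ + noiseMeas ε₂ S₂ := by
  classical
  rw [prob_eq]
  have n1 := noiseMeas_nonneg hR SR
  have n2 := noiseMeas_nonneg h₁ S₁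
  have n3 := noiseMeas_nonneg h₂ S₂
  refine div_le_of_le_mul₀ (by positivity) (by positivity) ?_
  have key : ∀ w v, ∑ zR, ∑ z₁, ∑ z₂,
      noiseProb εR zR * noiseProb ε₁ z₁ * noiseProb ε₂ z₂ *
        (if E w v (c.outputs w v N (zipNoise zR z₁ z₂)) then (1 : ℝ) else 0) ≤
      noiseMeas εR SR + noiseMeas ε₁ S₁ + noiseMeas ε₂ S₂ := by
    intro w v
    have e := sum_noiseProb_mul_three (N := N) εR ε₁ ε₂
    have e1 := e (fun a => if a ∈ SR then 1 else 0) (fun _ => 1) fun _ => 1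
    have e2 := e (fun _ => 1) (fun a => if a ∈ S₁ then 1 else 0) fun _ => 1
    have e3 := e (fun _ => 1) (fun _ => 1) fun a => if a ∈ S₂ then 1 else 0
    simp only [mul_one, sum_noiseProb, one_mul] at e1 e2 e3
    have hm : ∀ ε (S : Set (Fin N → Bit)),
        noiseMeas ε S = ∑ a, noiseProb ε a * if a ∈ S then 1 else 0 := fun ε S => by
      simp [noiseMeas]
    rw [hm, hm, hm, ← e1, ← e2, ← e3]
    simp_rw [← Finset.sum_add_distrib]
    refine Finset.sum_le_sum fun a _ => Finset.sum_le_sum fun b _ =>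
      Finset.sum_le_sum fun d _ => ?_
    have p1 := noiseProb_nonneg hR a
    have p2 := noiseProb_nonneg h₁ b
    have p3 := noiseProb_nonneg h₂ d
    have hp : 0 ≤ noiseProb εR a * noiseProb ε₁ b * noiseProb ε₂ d := by positivity
    have q : ∀ S : Set (Fin N → Bit), ∀ x, (0 : ℝ) ≤ if x ∈ S then 1 else 0 := fun S x => by
      split_ifs <;> norm_num
    have : (if E w v (c.outputs w v N (zipNoise a b d)) then (1 : ℝ) else 0) ≤
        (if a ∈ SR then 1 else 0) + (if b ∈ S₁ then 1 else 0) + if d ∈ S₂ then 1 else 0 := by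
      have q1 := q SR a
      have q2 := q S₁ b
      have q3 := q S₂ d
      by_cases hE : E w v (c.outputs w v N (zipNoise a b d))
      · rw [if_pos hE]
        rcases h w v a b d hE with h | h | h
        · rw [if_pos h]; linarith
        · rw [if_pos h]; linarith
        · rw [if_pos h]; linarith
      · rw [if_neg hE]; linarith
    refine (mul_le_mul_of_nonneg_left this hp).trans (le_of_eq ?_)
    ring
  refine (Finset.sum_le_sum fun w _ => Finset.sum_le_sum fun v _ => key w v).trans (le_of_eq ?_)
  simp only [Finset.sum_const, Finset.card_univ, nsmul_eq_mul]
  ring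

/-! ### Exchange of the terminals and unused channel uses -/

theorem swap_prob (εR ε₁ ε₂ : ℝ) (c : Code W V N) (E : W → V → Outputs N → Prop) :
    c.swap.prob εR ε₂ ε₁ (fun v w o => E w v ⟨o.yR, o.y₂, o.y₁⟩) = c.prob εR ε₁ ε₂ E := by
  classical
  rw [prob_eq, prob_eq, mul_comm]
  congr 1
  rw [Finset.sum_comm]
  refine Finset.sum_congr rfl fun w _ => Finset.sum_congr rfl fun v _ =>
    Finset.sum_congr rfl fun a _ => ?_
  rw [Finset.sum_comm]
  refine Finset.sum_congr rfl fun b _ => Finset.sum_congr rfl fun d _ => ?_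
  simp only [c.swap_outputs w v N a b d]
  ring

theorem swap_err₁ (εR ε₁ ε₂ : ℝ) (c : Code W V N) :
    c.swap.err₁ εR ε₂ ε₁ = c.err₂ εR ε₁ ε₂ :=
  swap_prob εR ε₁ ε₂ c fun w v o => c.dec₂ o.y₂ v ≠ w

theorem swap_err₂ (εR ε₁ ε₂ : ℝ) (c : Code W V N) :
    c.swap.err₂ εR ε₂ ε₁ = c.err₁ εR ε₁ ε₂ :=
  swap_prob εR ε₁ ε₂ c fun w v o => c.dec₁ o.y₁ w ≠ v

/-- By causality the first `N` outputs depend only on the first `N` noise symbols, so the noise of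
the added channel uses integrates to 1. -/
theorem extend_prob {W' V' : Type} [Fintype W'] [Fintype V'] {N' : ℕ} (εR ε₁ ε₂ : ℝ)
    (c : Code W V N) (h : N ≤ N') (e : W ≃ W') (f : V ≃ V') (E : W → V → Outputs N → Prop) :
    (c.extend h e f).prob εR ε₁ ε₂ (fun w v o => E (e.symm w) (f.symm v) (o.restrict h)) =
      c.prob εR ε₁ ε₂ E := by
  classical
  unfold prob
  rw [Fintype.card_congr e, Fintype.card_congr f]
  congr 1
  rw [← e.sum_comp]
  refine Finset.sum_congr rfl fun w _ => ?_
  rw [← f.sum_comp]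
  refine Finset.sum_congr rfl fun v _ => ?_
  have hsum : ∑ x : Bit × Bit × Bit, bern εR x.1 * bern ε₁ x.2.1 * bern ε₂ x.2.2 = 1 := by
    simp_rw [Fintype.sum_prod_type, ← Finset.mul_sum, sum_bern, mul_one, ← Finset.mul_sum,
      sum_bern, mul_one, sum_bern]
  rw [← sum_prod_mul_comp_injective (fun x : Bit × Bit × Bit =>
    bern εR x.1 * bern ε₁ x.2.1 * bern ε₂ x.2.2) hsum (Fin.castLE_injective h)]
  refine Finset.sum_congr rfl fun z _ => ?_
  rw [c.outputs_restrict w v h z,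
    (c.extend h e f).outputs_congr_enc c (e w) (f v) w v (by simp [extend]) (by simp [extend])
      (fun _ _ => rfl)]
  simp only [Equiv.symm_apply_apply]

theorem extend_err₁ {W' V' : Type} [Fintype W'] [Fintype V'] {N' : ℕ} (εR ε₁ ε₂ : ℝ)
    (c : Code W V N) (h : N ≤ N') (e : W ≃ W') (f : V ≃ V') :
    (c.extend h e f).err₁ εR ε₁ ε₂ = c.err₁ εR ε₁ ε₂ := by
  unfold err₁
  rw [← c.extend_prob εR ε₁ ε₂ h e f]
  simp only [extend, ne_eq, ← Equiv.eq_symm_apply, Outputs.restrict]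

theorem extend_err₂ {W' V' : Type} [Fintype W'] [Fintype V'] {N' : ℕ} (εR ε₁ ε₂ : ℝ)
    (c : Code W V N) (h : N ≤ N') (e : W ≃ W') (f : V ≃ V') :
    (c.extend h e f).err₂ εR ε₁ ε₂ = c.err₂ εR ε₁ ε₂ := by
  unfold err₂
  rw [← c.extend_prob εR ε₁ ε₂ h e f]
  simp only [extend, ne_eq, ← Equiv.eq_symm_apply, Outputs.restrict]

end Code

/-! ### The block structure of the time-sharing scheme -/

/-- Position of the `s`-th symbol of the `b`-th block. -/
def blockIdx {B n : ℕ} (b : Fin (B + 1)) (s : Fin n) : Fin ((B + 1) * n) :=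
  ⟨b * n + s, calc
    b * n + s < b * n + n := Nat.add_lt_add_left s.2 _
    _ = (b + 1) * n := by ring
    _ ≤ (B + 1) * n := Nat.mul_le_mul_right _ b.2⟩

theorem blockIdx_injective {B n : ℕ} (b : Fin (B + 1)) :
    Function.Injective (blockIdx (n := n) b) := fun s t h => by
  have := congrArg Fin.val h
  simp only [blockIdx] at this
  exact Fin.ext (by omega)

theorem mul_add_div_self {n : ℕ} (b : ℕ) (s : Fin n) : (b * n + s) / n = b := by
  rw [mul_comm, Nat.mul_add_div (Fin.pos s), Nat.div_eq_of_lt s.2, add_zero]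

theorem mul_add_mod_self {n : ℕ} (b : ℕ) (s : Fin n) : (b * n + s) % n = s := by
  rw [mul_comm, Nat.mul_add_mod, Nat.mod_eq_of_lt s.2]

theorem blockSymbol_apply {B n : ℕ} (x : Fin B → Fin n → Bit) (b : Fin B) (s : Fin n) :
    blockSymbol x (b * n + s) = x b s := by
  unfold blockSymbol
  have h : ((b : ℕ) * n + s) / n < B ∧ ((b : ℕ) * n + s) % n < n := by
    rw [mul_add_div_self, mul_add_mod_self]; exact ⟨b.2, s.2⟩
  rw [dif_pos h]
  congr
  · exact mul_add_div_self b s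
  · exact mul_add_mod_self b s

theorem block_apply {B n : ℕ} (y : Fin ((B + 1) * n) → Bit) (b : Fin (B + 1)) (s : Fin n) :
    block n y b s = y (blockIdx b s) :=
  dif_pos (blockIdx b s).2

namespace TimeSharing

variable {n₁ n₂ : ℕ} (S : TimeSharing n₁ n₂) {B : ℕ}

/-- In the first part terminal 2 is silent, so a private codeword plus noise arrives. In the second
part linearity turns the two superposed codewords into the single codeword of `(w b).2 + v b`. -/
theorem relayDec_eq {BP : Set (Fin n₁ → Bit)} {BC : Set (Fin n₂ → Bit)}
    (hP : ∀ x ∉ BP, ∀ i, S.relayPrivateDec (S.privateCode i + x) = i)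
    (hC : ∀ x ∉ BC, ∀ u, S.relayXorDec (S.commonCode u + x) = u)
    (w : Fin B → Fin S.K × (Fin S.k → Bit)) (v : Fin B → Fin S.k → Bit)
    (z : Fin ((B + 1) * (n₁ + n₂)) → Bit × Bit × Bit) (b : Fin B)
    (hzP : (fun s => (z (blockIdx b.castSucc (Fin.castAdd n₂ s))).1) ∉ BP)
    (hzC : (fun s => (z (blockIdx b.castSucc (Fin.natAdd n₁ s))).1) ∉ BC) :
    S.relayDec (block (n₁ + n₂) ((S.toCode B).outputs w v _ z).yR b) =
      ((w b).1, (w b).2 + v b) := by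
  have hy : ∀ s, block (n₁ + n₂) ((S.toCode B).outputs w v _ z).yR b s =
      Fin.append (S.privateCode (w b).1) (S.commonCode (w b).2) s +
      Fin.append (fun _ : Fin n₁ => (0 : Bit)) (S.commonCode (v b)) s +
      (z (blockIdx b.castSucc s)).1 := by
    intro s
    have h := ((S.toCode B).outputs_apply w v z (blockIdx b.castSucc s)).1
    have hb := block_apply ((S.toCode B).outputs w v _ z).yR b.castSucc s
    rw [Fin.val_castSucc] at hb
    rw [hb, h]
    simp only [toCode, blockIdx, Fin.val_castSucc, blockSymbol_apply]
  unfold relayDec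
  refine Prod.ext ?_ ?_
  · have := hP _ hzP (w b).1
    refine Eq.trans (congrArg S.relayPrivateDec ?_) this
    funext s
    simp [hy]
  · have := hC _ hzC ((w b).2 + v b)
    refine Eq.trans (congrArg S.relayXorDec ?_) this
    funext s
    simp [hy]

theorem block_relay (w : Fin B → Fin S.K × (Fin S.k → Bit)) (v : Fin B → Fin S.k → Bit)
    (z : Fin ((B + 1) * (n₁ + n₂)) → Bit × Bit × Bit) (b : Fin B)
    (h : S.relayDec (block (n₁ + n₂) ((S.toCode B).outputs w v _ z).yR b) =
      ((w b).1, (w b).2 + v b)) :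
    block (n₁ + n₂) ((S.toCode B).outputs w v _ z).y₁ (b + 1) =
        S.relayCode (w b).1 ((w b).2 + v b) + (fun s => (z (blockIdx b.succ s)).2.1) ∧
      block (n₁ + n₂) ((S.toCode B).outputs w v _ z).y₂ (b + 1) =
        S.relayCode (w b).1 ((w b).2 + v b) + (fun s => (z (blockIdx b.succ s)).2.2) := by
  have hr : ∀ s : Fin (n₁ + n₂), (S.toCode B).relay (blockIdx b.succ s)
      (((S.toCode B).outputs w v _ z).restrict (blockIdx b.succ s).2.le).yR =
        S.relayCode (w b).1 ((w b).2 + v b) s := by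
    intro s
    have hdiv : ((blockIdx b.succ s : Fin ((B + 1) * (n₁ + n₂))) : ℕ) / (n₁ + n₂) = b + 1 :=
      mul_add_div_self _ s
    have hmod : ((blockIdx b.succ s : Fin ((B + 1) * (n₁ + n₂))) : ℕ) % (n₁ + n₂) = s :=
      mul_add_mod_self _ s
    -- Block `b` is complete before block `b + 1` begins, so the relay's truncated past contains all
    -- of it and the default 0 in `block` is never read.
    have hblock : block (n₁ + n₂)
        (((S.toCode B).outputs w v _ z).restrict (blockIdx b.succ s).2.le).yR b =
        block (n₁ + n₂) ((S.toCode B).outputs w v _ z).yR b := by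
      funext s'
      have h1 : (b : ℕ) * (n₁ + n₂) + s' < (blockIdx b.succ s : Fin ((B + 1) * (n₁ + n₂))) := by
        have : ((b : ℕ) + 1) * (n₁ + n₂) = b * (n₁ + n₂) + (n₁ + n₂) := by ring
        simp only [blockIdx, Fin.val_succ, this]
        have := s'.2
        omega
      have h2 := h1.trans (blockIdx b.succ s).2
      simp only [block, dif_pos h1, dif_pos h2]
      rfl
    simp only [toCode]
    rw [dif_pos ⟨by rw [hdiv]; exact Nat.succ_pos _, by rw [hmod]; exact s.2⟩]
    simp only [hdiv, Nat.add_sub_cancel]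
    simp only [toCode] at hblock h
    rw [hblock, h]
    congr
  constructor
  · funext s
    have hb := block_apply ((S.toCode B).outputs w v _ z).y₁ b.succ s
    rw [Fin.val_succ] at hb
    rw [hb, ((S.toCode B).outputs_apply w v z (blockIdx b.succ s)).2.1, hr]
    rfl
  · funext s
    have hb := block_apply ((S.toCode B).outputs w v _ z).y₂ b.succ s
    rw [Fin.val_succ] at hb
    rw [hb, ((S.toCode B).outputs_apply w v z (blockIdx b.succ s)).2.2, hr]
    rfl

/-- Error bounds for a scheme whose component decoders work outside exceptional noise sets. -/
theorem err_le {εR ε₁ ε₂ : ℝ} (hR : εR ∈ Set.Icc (0 : ℝ) 1) (h₁ : ε₁ ∈ Set.Icc (0 : ℝ) 1)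
    (h₂ : ε₂ ∈ Set.Icc (0 : ℝ) 1) {BP : Set (Fin n₁ → Bit)} {BC : Set (Fin n₂ → Bit)}
    {B₁ B₂ : Set (Fin (n₁ + n₂) → Bit)}
    (hP : ∀ x ∉ BP, ∀ i, S.relayPrivateDec (S.privateCode i + x) = i)
    (hC : ∀ x ∉ BC, ∀ u, S.relayXorDec (S.commonCode u + x) = u)
    (hd₁ : ∀ x ∉ B₁, ∀ i u, S.dec₁ i (S.relayCode i u + x) = u)
    (hd₂ : ∀ x ∉ B₂, ∀ i u, S.dec₂ (S.relayCode i u + x) = (i, u)) {η : ℝ}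
    (eP : noiseMeas εR BP ≤ η) (eC : noiseMeas εR BC ≤ η) (e₁ : noiseMeas ε₁ B₁ ≤ η)
    (e₂ : noiseMeas ε₂ B₂ ≤ η) (B : ℕ) :
    S.relayErr B εR ε₁ ε₂ ≤ B * (3 * η) ∧ (S.toCode B).err₁ εR ε₁ ε₂ ≤ B * (3 * η) ∧
      (S.toCode B).err₂ εR ε₁ ε₂ ≤ B * (3 * η) := by
  -- Each block contributes `2 * η` through the two relay decoders and a further `η` through the
  -- terminal, which gives the factor 3.
  let SR : Set (Fin ((B + 1) * (n₁ + n₂)) → Bit) := {z | ∃ b : Fin B, z ∈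
    {z | (fun s => z (blockIdx b.castSucc (Fin.castAdd n₂ s))) ∈ BP} ∪
    {z | (fun s => z (blockIdx b.castSucc (Fin.natAdd n₁ s))) ∈ BC}}
  let S' : Set (Fin (n₁ + n₂) → Bit) → Set (Fin ((B + 1) * (n₁ + n₂)) → Bit) := fun B' =>
    {z | ∃ b : Fin B, z ∈ {z | (fun s => z (blockIdx b.succ s)) ∈ B'}}
  have hη : 0 ≤ η := (noiseMeas_nonneg hR _).trans eP
  have mR : noiseMeas εR SR ≤ B * (2 * η) := by
    refine (noiseMeas_exists_le hR _).trans ?_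
    refine (Finset.sum_le_sum fun b _ => (noiseMeas_union_le hR _ _).trans (add_le_add
      ((noiseMeas_comp_injective εR (J := fun s => blockIdx b.castSucc (Fin.castAdd n₂ s))
        ((blockIdx_injective _).comp (Fin.castAdd_injective _ _)) BP).le.trans eP)
      ((noiseMeas_comp_injective εR (J := fun s => blockIdx b.castSucc (Fin.natAdd n₁ s))
        ((blockIdx_injective _).comp (Fin.natAdd_injective _ _)) BC).le.trans eC))).trans ?_
    simp only [Finset.sum_const, Finset.card_univ, Fintype.card_fin, nsmul_eq_mul]
    rw [two_mul]
  have mS : ∀ {ε : ℝ}, ε ∈ Set.Icc (0 : ℝ) 1 → ∀ B', noiseMeas ε B' ≤ η →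
      noiseMeas ε (S' B') ≤ B * η := by
    intro ε hε B' hB'
    refine (noiseMeas_exists_le hε _).trans ?_
    refine (Finset.sum_le_sum fun b _ =>
      (noiseMeas_comp_injective ε (blockIdx_injective b.succ) B').le.trans hB').trans ?_
    simp
  have hrel : ∀ w v zR z₁ z₂, zR ∉ SR → ∀ b : Fin B,
      S.relayDec (block (n₁ + n₂) ((S.toCode B).outputs w v _ (zipNoise zR z₁ z₂)).yR b) =
        ((w b).1, (w b).2 + v b) := by
    intro w v zR z₁ z₂ hz b
    simp only [SR, Set.mem_ofPred_eq, not_exists, Set.mem_union, not_or] at hz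
    exact S.relayDec_eq hP hC w v _ b (hz b).1 (hz b).2
  have hself : ∀ a b : Fin S.k → Bit, a + b + a = b := fun a b => by
    funext i
    simp only [Pi.add_apply]
    generalize a i = x
    generalize b i = y
    revert x y; decide
  have hself' : ∀ a b : Fin S.k → Bit, a + b + b = a := fun a b => by
    rw [add_comm a b, hself]
  have hBη : 0 ≤ B * η := by positivity
  refine ⟨?_, ?_, ?_⟩
  · refine ((S.toCode B).prob_le hR h₁ h₂ _ SR ∅ ∅ ?_).trans ?_
    · rintro w v zR z₁ z₂ ⟨b, hb⟩
      by_contra hcon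
      exact hb (hrel w v zR z₁ z₂ (fun h => hcon (Or.inl h)) b)
    · rw [noiseMeas_empty, noiseMeas_empty]; linarith
  · refine ((S.toCode B).prob_le hR h₁ h₂ _ SR (S' B₁) ∅ ?_).trans ?_
    · intro w v zR z₁ z₂ hE
      by_contra hcon
      rw [not_or, not_or] at hcon
      refine hE ?_
      funext b
      have h := (S.block_relay w v (zipNoise zR z₁ z₂) b (hrel w v zR z₁ z₂ hcon.1 b)).1
      change _ = _ + (fun s => z₁ (blockIdx b.succ s)) at h
      change S.dec₁ (w b).1 (block (n₁ + n₂) _ (b + 1)) + (w b).2 = v b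
      rw [h, hd₁ _ (fun hb => hcon.2.1 ⟨b, hb⟩), hself]
    · rw [noiseMeas_empty]; linarith [mS h₁ B₁ e₁]
  · refine ((S.toCode B).prob_le hR h₁ h₂ _ SR ∅ (S' B₂) ?_).trans ?_
    · intro w v zR z₁ z₂ hE
      by_contra hcon
      rw [not_or, not_or] at hcon
      refine hE ?_
      funext b
      have h := (S.block_relay w v (zipNoise zR z₁ z₂) b (hrel w v zR z₁ z₂ hcon.1 b)).2
      change _ = _ + (fun s => z₂ (blockIdx b.succ s)) at h
      change ((S.dec₂ (block (n₁ + n₂) _ (b + 1))).1,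
        (S.dec₂ (block (n₁ + n₂) _ (b + 1))).2 + v b) = w b
      rw [h, hd₂ _ (fun hb => hcon.2.2 ⟨b, hb⟩), hself']
    · rw [noiseMeas_empty]; linarith [mS h₂ B₂ e₂]

end TimeSharing

/-! ### Existence of good schemes -/

theorem card_erase_zero (k : ℕ) :
    (((Finset.univ : Finset (Fin k → Bit)).erase 0).card : ℝ) = 2 ^ k - 1 := by
  rw [Finset.card_erase_of_mem (Finset.mem_univ _), Finset.card_univ,
    Nat.cast_sub Fintype.card_pos]
  simp

/-- A nonzero `d` in the kernel would leave every word of `T` inside `T`, making all noise bad.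
Small error thus yields injectivity without expurgation. -/
theorem injective_of_noiseMeas_badNoise_lt_one {k n : ℕ} {ε : ℝ} {T : Finset (Fin n → Bit)}
    {a : Fin k → Fin n → Bit}
    (h : noiseMeas ε (badNoise T (Finset.univ.erase 0) a) < 1) :
    Function.Injective (Fintype.linearCombination Bit a) := by
  refine (injective_iff_map_eq_zero _).2 fun d hd => ?_
  by_contra hne
  refine h.ne ?_
  have : badNoise T (Finset.univ.erase 0) a = Set.univ := by
    refine Set.eq_univ_of_forall fun z => ?_
    by_cases hz : z ∈ T
    · exact Or.inr ⟨d, by simpa using hne, by rwa [hd, add_zero]⟩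
    · exact Or.inl hz
  rw [this, noiseMeas_univ]

theorem exists_timeSharing {n₁ n₂ k' k : ℕ} {εR ε₁ ε₂ η : ℝ} (hR : εR ∈ Set.Icc (0 : ℝ) 1)
    (h₁ : ε₁ ∈ Set.Icc (0 : ℝ) 1) (h₂ : ε₂ ∈ Set.Icc (0 : ℝ) 1) (hη : 4 * η < 1)
    (TP : Finset (Fin n₁ → Bit)) (TC : Finset (Fin n₂ → Bit))
    (T₁ T₂ : Finset (Fin (n₁ + n₂) → Bit))
    (mP : noiseMeas εR ((TP : Set (Fin n₁ → Bit))ᶜ) ≤ η)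
    (cP : ((2 : ℝ) ^ k' - 1) * TP.card ≤ η * 2 ^ n₁)
    (mC : noiseMeas εR ((TC : Set (Fin n₂ → Bit))ᶜ) ≤ η)
    (cC : ((2 : ℝ) ^ k - 1) * TC.card ≤ η * 2 ^ n₂)
    (m₁ : noiseMeas ε₁ ((T₁ : Set (Fin (n₁ + n₂) → Bit))ᶜ) ≤ η)
    (c₁ : ((2 : ℝ) ^ k - 1) * T₁.card ≤ η * 2 ^ (n₁ + n₂))
    (m₂ : noiseMeas ε₂ ((T₂ : Set (Fin (n₁ + n₂) → Bit))ᶜ) ≤ η)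
    (c₂ : ((2 : ℝ) ^ (k' + k) - 1) * T₂.card ≤ η * 2 ^ (n₁ + n₂)) :
    ∃ S : TimeSharing n₁ n₂, S.K = 2 ^ k' ∧ S.k = k ∧ ∀ B : ℕ,
      S.relayErr B εR ε₁ ε₂ ≤ B * (3 * (4 * η)) ∧
      (S.toCode B).err₁ εR ε₁ ε₂ ≤ B * (3 * (4 * η)) ∧
      (S.toCode B).err₂ εR ε₁ ε₂ ≤ B * (3 * (4 * η)) := by
  classical
  let e : Fin (2 ^ k') ≃ (Fin k' → Bit) := Fintype.equivOfCardEq (by simp)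
  have cP' : (((Finset.univ : Finset (Fin k' → Bit)).erase 0).card : ℝ) * TP.card
      ≤ η * 2 ^ n₁ := by rwa [card_erase_zero]
  have cC' : (((Finset.univ : Finset (Fin k → Bit)).erase 0).card : ℝ) * TC.card
      ≤ η * 2 ^ n₂ := by rwa [card_erase_zero]
  -- Each uplink code has only one receiver, so the two-receiver lemma is used with identical data.
  -- The private code, too, is taken linear.
  obtain ⟨aP, haP, -⟩ := exists_noiseMeas_badNoise_le hR hR TP TP _ _
    (Finset.notMem_erase _ _) (Finset.notMem_erase _ _) mP cP' mP cP'
  obtain ⟨aC, haC, -⟩ := exists_noiseMeas_badNoise_le hR hR TC TC _ _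
    (Finset.notMem_erase _ _) (Finset.notMem_erase _ _) mC cC' mC cC'
  let J : (Fin k → Bit) →+ (Fin k' ⊕ Fin k → Bit) :=
    { toFun := fun u => Sum.elim 0 u
      map_zero' := by ext x; cases x <;> rfl
      map_add' := fun u v => by ext x; cases x <;> simp }
  have hJ : Function.Injective J := fun u v h => funext fun j => congrFun h (Sum.inr j)
  -- The competitors at terminal 1: the private coordinates are known, so differences live only in
  -- the `k` common coordinates.
  let D₁ : Finset (Fin k' ⊕ Fin k → Bit) := (Finset.univ.erase (0 : Fin k → Bit)).image J
  have hD₁ : (0 : Fin k' ⊕ Fin k → Bit) ∉ D₁ := by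
    simp only [D₁, Finset.mem_image, Finset.mem_erase, not_exists, not_and]
    rintro u ⟨hu, -⟩ h
    exact hu (hJ (h.trans (map_zero J).symm))
  obtain ⟨a, ha₁, ha₂⟩ := exists_noiseMeas_badNoise_le h₁ h₂ T₁ T₂ D₁ (Finset.univ.erase 0)
    hD₁ (Finset.notMem_erase _ _) m₁
    (by rw [Finset.card_image_of_injective _ hJ, card_erase_zero]; exact c₁) m₂
    (by
      rw [Finset.card_erase_of_mem (Finset.mem_univ _), Finset.card_univ,
        Nat.cast_sub Fintype.card_pos]
      simpa using c₂)
  let LP := Fintype.linearCombination Bit aP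
  let LC := Fintype.linearCombination Bit aC
  let L := Fintype.linearCombination Bit a
  obtain ⟨decP, hdecP⟩ := exists_decoder LP.toAddMonoidHom TP
  obtain ⟨decC, hdecC⟩ := exists_decoder LC.toAddMonoidHom TC
  obtain ⟨dec₁, hdec₁⟩ := exists_decoder (L.toAddMonoidHom.comp J) T₁
  obtain ⟨dec₂, hdec₂⟩ := exists_decoder L.toAddMonoidHom T₂
  let S : TimeSharing n₁ n₂ :=
    { K := 2 ^ k'
      K_pos := by positivity
      privateCode := fun i => LP (e i)
      k := k
      commonCode := LC
      commonCode_injective := injective_of_noiseMeas_badNoise_lt_one (haC.trans_lt hη)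
      relayPrivateDec := fun y => e.symm (decP y)
      relayXorDec := decC
      relayCode := fun i u => L (Sum.elim (e i) u)
      dec₁ := fun i y => dec₁ (y - L (Sum.elim (e i) 0))
      dec₂ := fun y => (e.symm fun j => dec₂ y (Sum.inl j), fun j => dec₂ y (Sum.inr j)) }
  refine ⟨S, rfl, rfl, S.err_le hR h₁ h₂ (fun x hx i => ?_) (fun x hx u => ?_)
    (fun x hx i u => ?_) (fun x hx i u => ?_) haP haC ha₁ ha₂⟩
  · simp only [badNoise, Set.mem_ofPred_eq, not_or, not_not, not_exists, not_and] at hx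
    exact e.symm_apply_eq.2 (hdecP x (e i) hx.1 fun d hd => hx.2 d (by simpa using hd))
  · simp only [badNoise, Set.mem_ofPred_eq, not_or, not_not, not_exists, not_and] at hx
    exact hdecC x u hx.1 fun d hd => hx.2 d (by simpa using hd)
  · simp only [badNoise, Set.mem_ofPred_eq, not_or, not_not, not_exists, not_and] at hx
    have hsplit : (Sum.elim (e i) u : Fin k' ⊕ Fin k → Bit) = Sum.elim (e i) 0 + J u := by
      ext x; cases x <;> simp [J]
    change dec₁ (L (Sum.elim (e i) u) + x - L (Sum.elim (e i) 0)) = u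
    rw [hsplit, map_add, add_assoc, add_sub_cancel_left]
    exact hdec₁ x u hx.1 fun d hd => hx.2 (J d)
      (Finset.mem_image_of_mem _ (by simpa using hd))
  · simp only [badNoise, Set.mem_ofPred_eq, not_or, not_not, not_exists, not_and] at hx
    have h := hdec₂ x (Sum.elim (e i) u) hx.1 fun d hd => hx.2 d (by simpa using hd)
    change (e.symm fun j => dec₂ (L (Sum.elim (e i) u) + x) (Sum.inl j),
      fun j => dec₂ (L (Sum.elim (e i) u) + x) (Sum.inr j)) = (i, u)
    change dec₂ (L (Sum.elim (e i) u) + x) = _ at h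
    rw [h]
    simp

theorem natFloor_le_max (x : ℝ) : (⌊x⌋₊ : ℝ) ≤ max 0 x := by
  rcases le_total 0 x with h | h
  · exact (Nat.floor_le h).trans (le_max_right _ _)
  · rw [Nat.floor_of_nonpos h, Nat.cast_zero]; exact le_max_left _ _

theorem natFloor_mul_le {α : ℝ} (h1 : α ≤ 1) (n : ℕ) : ⌊α * n⌋₊ ≤ n :=
  Nat.floor_le_of_le (mul_le_of_le_one_left n.cast_nonneg h1)

theorem TimeSharing.rate_toCode {n₁ n₂ : ℕ} (S : TimeSharing n₁ n₂) {k' k : ℕ}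
    (hK : S.K = 2 ^ k') (hk : S.k = k) (B : ℕ) :
    (S.toCode B).rate₁₂ = (B : ℝ) / (B + 1) * (((k' : ℝ) + k) / ((n₁ + n₂ : ℕ) : ℝ)) ∧
      (S.toCode B).rate₂₁ = (B : ℝ) / (B + 1) * ((k : ℝ) / ((n₁ + n₂ : ℕ) : ℝ)) := by
  have hl : ∀ m : ℕ, Real.logb 2 ((2 : ℝ) ^ m) = m := fun m => by
    rw [← Real.rpow_natCast, Real.logb_rpow two_pos (by norm_num)]
  constructor
  · simp only [Code.rate₁₂, Fintype.card_pi, Fintype.card_prod, Fintype.card_fin, hK, hk,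
      Finset.prod_const, Finset.card_univ, ZMod.card]
    rw [← pow_add, ← pow_mul]
    push_cast
    rw [hl, div_mul_div_comm]
    push_cast
    ring
  · simp only [Code.rate₂₁, Fintype.card_pi, Fintype.card_fin, hk,
      Finset.prod_const, Finset.card_univ, ZMod.card]
    rw [← pow_mul]
    push_cast
    rw [hl, div_mul_div_comm]
    push_cast
    ring

theorem eventually_le_div_add_one_mul (R : ℝ) {δ : ℝ} (hδ : 0 < δ) :
    ∀ᶠ B : ℕ in atTop, R - δ ≤ (B : ℝ) / (B + 1) * (R - δ / 2) := by
  have h : Tendsto (fun B : ℕ => (B : ℝ) / (B + 1) * (R - δ / 2)) atTop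
      (nhds (1 * (R - δ / 2))) := (tendsto_natCast_div_add_atTop (1 : ℝ)).mul_const _
  filter_upwards [h.eventually (lt_mem_nhds (show R - δ < 1 * (R - δ / 2) by linarith))] with B hB
  exact hB.le

/-- Time-sharing with the fraction `α` achieves all rates within the bounds of its components. -/
theorem timeSharingAchieves {εR ε₁ ε₂ α R₁₂ R₂₁ : ℝ} (hR : εR ∈ Set.Icc (0 : ℝ) 1)
    (h₁ : ε₁ ∈ Set.Icc (0 : ℝ) 1) (h₂ : ε₂ ∈ Set.Icc (0 : ℝ) 1) (hα0 : 0 ≤ α) (hα1 : α ≤ 1)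
    (h0 : 0 ≤ R₂₁) (hRR : R₂₁ ≤ R₁₂) (hP : R₁₂ - R₂₁ ≤ (1 - α) * (1 - binEntropy₂ εR))
    (hC : R₂₁ ≤ α * (1 - binEntropy₂ εR)) (hd₁ : R₂₁ ≤ 1 - binEntropy₂ ε₁)
    (hd₂ : R₁₂ ≤ 1 - binEntropy₂ ε₂) : TimeSharingAchieves εR ε₁ ε₂ α R₁₂ R₂₁ := by
  refine ⟨hα0, hα1, fun δ hδ => ?_⟩
  filter_upwards [eventually_le_div_add_one_mul R₁₂ hδ, eventually_le_div_add_one_mul R₂₁ hδ]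
    with B hB₁₂ hB₂₁
  -- Each of the two rates loses `d` as margin and at most another `d` by rounding. Their sum loses
  -- at most `4 * d = δ / 2`, and the factor `B / (B + 1)` may take the rest.
  set d : ℝ := δ / 8 with hd
  have hd0 : 0 < d := by positivity
  -- The bound 1/8 ensures injectivity of the common code; the other makes the union bound `B * (3 *
  -- (4 * η))` at most `δ`. As `η` depends on `B`, the block length must be chosen after `B`.
  set η : ℝ := min (1 / 8) (δ / (12 * (B + 1))) with hη
  have hη0 : 0 < η := by positivity
  have hη1 : 4 * η < 1 := by
    have := min_le_left (1 / 8) (δ / (12 * ((B : ℝ) + 1)))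
    linarith
  have hη2 : B * (3 * (4 * η)) ≤ δ := by
    have h := min_le_right (1 / 8) (δ / (12 * ((B : ℝ) + 1)))
    rw [← hη, le_div_iff₀ (by positivity)] at h
    nlinarith
  have hfl : Tendsto (fun n : ℕ => (⌊α * n⌋₊ : ℝ) / n) atTop (nhds α) :=
    (tendsto_nat_floor_mul_div_atTop hα0).comp tendsto_natCast_atTop_atTop
  have hN₁ : Tendsto (fun n : ℕ => ((n - ⌊α * n⌋₊ : ℕ) : ℝ) / n) atTop (nhds (1 - α)) := by
    refine (tendsto_const_nhds.sub hfl).congr' ?_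
    filter_upwards [eventually_ne_atTop 0] with n hn
    have : (n : ℝ) ≠ 0 := by exact_mod_cast hn
    rw [Nat.cast_sub (natFloor_mul_le hα1 n)]
    field_simp
  have hN : Tendsto (fun n : ℕ => ((n - ⌊α * n⌋₊ + ⌊α * n⌋₊ : ℕ) : ℝ) / n) atTop (nhds 1) := by
    refine tendsto_const_nhds.congr' ?_
    filter_upwards [eventually_ne_atTop 0] with n hn
    have : (n : ℝ) ≠ 0 := by exact_mod_cast hn
    rw [Nat.sub_add_cancel (natFloor_mul_le hα1 n), div_self this]
  filter_upwards [
    exists_typicalSet hR hN₁ (by linarith) (by linarith) hP hd0 hη0,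
    exists_typicalSet hR hfl hα0 hα1 hC hd0 hη0,
    exists_typicalSet (R := R₂₁) h₁ hN zero_le_one le_rfl (by rwa [one_mul]) hd0 hη0,
    exists_typicalSet (R := R₁₂) h₂ hN zero_le_one le_rfl (by rwa [one_mul]) hd0 hη0,
    eventually_gt_atTop 0, (tendsto_natCast_atTop_atTop (R := ℝ)).eventually_ge_atTop (1 / d)]
    with n nP nC n₁ n₂ hn0 hnd
  have hn : (0 : ℝ) < n := by exact_mod_cast hn0
  set k' : ℕ := ⌊n * (R₁₂ - R₂₁ - d)⌋₊ with hk'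
  set k : ℕ := ⌊n * (R₂₁ - d)⌋₊ with hk
  have bk' := natFloor_le_max (n * (R₁₂ - R₂₁ - d))
  have bk := natFloor_le_max (n * (R₂₁ - d))
  rw [← hk'] at bk'
  rw [← hk] at bk
  have bkk : ((k' + k : ℕ) : ℝ) ≤ max 0 (n * (R₁₂ - d)) := by
    push_cast
    rcases le_total (n * (R₁₂ - R₂₁ - d)) 0 with h | h
    · rw [max_eq_left h] at bk'
      have : max 0 (n * (R₂₁ - d)) ≤ max 0 (n * (R₁₂ - d)) :=
        max_le_max le_rfl (mul_le_mul_of_nonneg_left (by linarith) hn.le)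
      linarith
    · rw [max_eq_right h] at bk'
      have hd' : 0 ≤ n * d := by positivity
      refine le_trans ?_ (le_max_right _ _)
      rcases le_total (n * (R₂₁ - d)) 0 with h' | h'
      · rw [max_eq_left h'] at bk
        have hk0 : k = 0 := by exact_mod_cast le_antisymm bk k.cast_nonneg
        have h21 : (k : ℝ) = 0 := by rw [hk0, Nat.cast_zero]
        nlinarith
      · rw [max_eq_right h'] at bk
        nlinarith
  obtain ⟨TP, mP, cP⟩ := nP k' bk'
  obtain ⟨TC, mC, cC⟩ := nC k bk
  obtain ⟨T₁, m₁, c₁⟩ := n₁ k bk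
  obtain ⟨T₂, m₂, c₂⟩ := n₂ (k' + k) bkk
  obtain ⟨S, hSK, hSk, hS⟩ := exists_timeSharing hR h₁ h₂ hη1 TP TC T₁ T₂ mP cP mC cC m₁ c₁ m₂ c₂
  have hnd' : 1 ≤ n * d := by rwa [div_le_iff₀ hd0] at hnd
  have fk' : R₁₂ - R₂₁ - 2 * d ≤ (k' : ℝ) / n := by
    rw [le_div_iff₀ hn]
    have := (Nat.lt_floor_add_one (n * (R₁₂ - R₂₁ - d)))
    rw [← hk'] at this
    nlinarith
  have fk : R₂₁ - 2 * d ≤ (k : ℝ) / n := by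
    rw [le_div_iff₀ hn]
    have := (Nat.lt_floor_add_one (n * (R₂₁ - d)))
    rw [← hk] at this
    nlinarith
  have hlen : ((n - ⌊α * n⌋₊ + ⌊α * n⌋₊ : ℕ) : ℝ) = n := by
    rw [Nat.sub_add_cancel (natFloor_mul_le hα1 n)]
  have hrate := S.rate_toCode hSK hSk B
  simp only [hlen] at hrate
  have hBB : (0 : ℝ) ≤ (B : ℝ) / (B + 1) := by positivity
  refine ⟨S, ?_, ?_, ?_, ?_, (hS B).1.trans hη2, (hS B).2.1.trans hη2, (hS B).2.2.trans hη2⟩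
  · rw [hSK]
    push_cast
    rw [← Real.rpow_natCast, Real.logb_rpow two_pos (by norm_num)]
    linarith
  · rw [hSk]; linarith
  · rw [hrate.1, add_div]
    exact hB₁₂.trans (mul_le_mul_of_nonneg_left (by linarith) hBB)
  · rw [hrate.2]
    exact hB₂₁.trans (mul_le_mul_of_nonneg_left (by linarith) hBB)

/-! ### Achievability -/

theorem Achievable.swap {εR ε₁ ε₂ R₁₂ R₂₁ : ℝ} (h : Achievable εR ε₂ ε₁ R₂₁ R₁₂) :
    Achievable εR ε₁ ε₂ R₁₂ R₂₁ := by
  intro δ hδ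
  filter_upwards [h δ hδ] with N ⟨M, M', hM, hM', c, hr, hr', he, he'⟩
  exact ⟨M', M, hM', hM, c.swap, hr', hr, by rwa [c.swap_err₁ εR ε₂ ε₁],
    by rwa [c.swap_err₂ εR ε₂ ε₁]⟩

theorem le_div_of_le_div_of_sub_le {r l δ b : ℝ} {N' N : ℕ} (hr : r ≤ l / N') (hl : 0 ≤ l)
    (hN : 0 < N) (hN' : N' ≤ N) (hb : (N : ℝ) - N' ≤ b) (hδ : |r| * b ≤ δ * N) :
    r - δ ≤ l / N := by
  have hN0 : (0 : ℝ) < N := by exact_mod_cast hN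
  have h1 : r * N' ≤ l := by
    rcases N'.eq_zero_or_pos with h0 | h0
    · rw [h0, Nat.cast_zero, mul_zero]; exact hl
    · rwa [le_div_iff₀ (by exact_mod_cast h0)] at hr
  have h2 : (0 : ℝ) ≤ N - N' := sub_nonneg.2 (by exact_mod_cast hN')
  have h3 : r * (N - N') ≤ |r| * b :=
    (mul_le_mul_of_nonneg_right (le_abs_self r) h2).trans
      (mul_le_mul_of_nonneg_left hb (abs_nonneg r))
  rw [le_div_iff₀ hN0]
  linarith

/-- One suitable `B` is fixed and the block length is `N / (B + 1)`. Fewer than `B + 1` channel uses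
stay idle, a rate loss that vanishes as `N` grows. -/
theorem TimeSharingAchieves.achievable {εR ε₁ ε₂ α R₁₂ R₂₁ : ℝ}
    (h : TimeSharingAchieves εR ε₁ ε₂ α R₁₂ R₂₁) : Achievable εR ε₁ ε₂ R₁₂ R₂₁ := by
  intro δ hδ
  obtain ⟨-, hα1, h⟩ := h
  obtain ⟨B, hB⟩ := (h (δ / 2) (half_pos hδ)).exists
  have hlim : ∀ r : ℝ, ∀ᶠ N : ℕ in atTop, |r| * (B + 1) ≤ δ / 2 * N := fun r =>
    ((tendsto_natCast_atTop_atTop (R := ℝ)).const_mul_atTop (half_pos hδ)).eventually_ge_atTop _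
  have hdiv : Tendsto (fun N : ℕ => N / (B + 1)) atTop atTop :=
    Nat.tendsto_div_const_atTop (Nat.succ_ne_zero B)
  filter_upwards [hlim (R₁₂ - δ / 2), hlim (R₂₁ - δ / 2), hdiv.eventually hB,
    eventually_gt_atTop 0] with N hN₁₂ hN₂₁ hex hN0
  obtain ⟨S, -, -, hr₁₂, hr₂₁, -, he₁, he₂⟩ := hex
  have hlen : N / (B + 1) - ⌊α * (N / (B + 1) : ℕ)⌋₊ + ⌊α * (N / (B + 1) : ℕ)⌋₊ = N / (B + 1) :=
    Nat.sub_add_cancel (natFloor_mul_le hα1 _)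
  have hle : (B + 1) * (N / (B + 1) - ⌊α * (N / (B + 1) : ℕ)⌋₊ + ⌊α * (N / (B + 1) : ℕ)⌋₊) ≤ N := by
    rw [hlen]; exact Nat.mul_div_le N (B + 1)
  have hsub : (N : ℝ) - ((B + 1) * (N / (B + 1) - ⌊α * (N / (B + 1) : ℕ)⌋₊ +
      ⌊α * (N / (B + 1) : ℕ)⌋₊) : ℕ) ≤ (B : ℝ) + 1 := by
    rw [hlen, sub_le_iff_le_add]
    have h1 := Nat.div_add_mod N (B + 1)
    have h2 := Nat.mod_lt N (Nat.succ_pos B)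
    have h3 : N ≤ B + 1 + (B + 1) * (N / (B + 1)) := by
      have : N % (B + 1) < B + 1 := h2
      omega
    exact_mod_cast h3
  have : Nonempty (Fin S.K) := ⟨⟨0, S.K_pos⟩⟩
  have e₁₂ := Fintype.equivFin (Fin B → Fin S.K × (Fin S.k → Bit))
  have e₂₁ := Fintype.equivFin (Fin B → Fin S.k → Bit)
  have hlog : ∀ {M : ℕ}, 0 < M → 0 ≤ Real.logb 2 M := fun hM =>
    Real.logb_nonneg one_lt_two (by exact_mod_cast hM)
  refine ⟨_, _, Fintype.card_pos, Fintype.card_pos, (S.toCode B).extend hle e₁₂ e₂₁, ?_, ?_,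
    ?_, ?_⟩
  · have := le_div_of_le_div_of_sub_le hr₁₂ (hlog Fintype.card_pos) hN0 hle hsub hN₁₂
    rw [Code.rate₁₂, Fintype.card_fin]
    linarith
  · have := le_div_of_le_div_of_sub_le hr₂₁ (hlog Fintype.card_pos) hN0 hle hsub hN₂₁
    rw [Code.rate₂₁, Fintype.card_fin]
    linarith
  · rw [Code.extend_err₁]; linarith
  · rw [Code.extend_err₂]; linarith

theorem binEntropy₂_le_one (ε : ℝ) : binEntropy₂ ε ≤ 1 :=
  (div_le_one (Real.log_pos one_lt_two)).2 Real.binEntropy_le_log_two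

/-- This fraction makes the common-code constraint tight, leaving `(1 - H(ε_R)) - R₂₁` for the
private rate. -/
theorem exists_timeSharingAchieves {εR ε₁ ε₂ R₁₂ R₂₁ : ℝ} (hR : εR ∈ Set.Icc (0 : ℝ) 1)
    (h₁ : ε₁ ∈ Set.Icc (0 : ℝ) 1) (h₂ : ε₂ ∈ Set.Icc (0 : ℝ) 1) (h0 : 0 ≤ R₂₁)
    (hRR : R₂₁ ≤ R₁₂) (hb₁₂ : R₁₂ ≤ rateBound εR ε₂) (hb₂₁ : R₂₁ ≤ rateBound εR ε₁) :
    TimeSharingAchieves εR ε₁ ε₂ (R₂₁ / (1 - binEntropy₂ εR)) R₁₂ R₂₁ := by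
  obtain ⟨a₁, a₂⟩ := le_min_iff.1 hb₁₂
  obtain ⟨b₁, b₂⟩ := le_min_iff.1 hb₂₁
  have hC := sub_nonneg.2 (binEntropy₂_le_one εR)
  have hmul : R₂₁ / (1 - binEntropy₂ εR) * (1 - binEntropy₂ εR) = R₂₁ := by
    -- If the uplink capacity is 0, then `R₂₁ = 0` as well, and the identity holds with 0/0 = 0.
    rcases hC.eq_or_lt with h | h
    · rw [← h] at b₁ ⊢
      rw [mul_zero]; linarith
    · field_simp
  exact timeSharingAchieves hR h₁ h₂ (div_nonneg h0 hC) (div_le_one_of_le₀ b₁ hC) h0 hRR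
    (by rw [sub_mul, hmul]; linarith) hmul.ge b₂ a₂

/-! ### Converse -/

open Classical in
/-- A decoder that recovers the message and the noise from the channel output succeeds rarely when
there are more messages than typical outputs. -/
theorem sum_noiseProb_le_of_injOn {ε : ℝ} (hε : ε ∈ Set.Icc (0 : ℝ) 1) {W : Type} [Fintype W]
    {n : ℕ} (A : W → (Fin n → Bit) → Prop) (f : W → (Fin n → Bit) → (Fin n → Bit))
    (hf : ∀ w z w' z', A w z → A w' z' → f w z = f w' z' → w = w' ∧ z = z') {a : ℝ} (ha : 0 ≤ a) :
    ∑ w, ∑ z, noiseProb ε z * (if A w z then 1 else 0) ≤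
      Fintype.card W * noiseMeas ε {z : Fin n → Bit | a < noiseProb ε z} + 2 ^ n * a := by
  -- Noise words of probability above `a` are charged to the tail. Each remaining successful pair
  -- weighs at most `a`, and injectivity of `f` limits the number of such pairs to `2 ^ n`.
  have h1 : ∀ w z, noiseProb ε z * (if A w z then (1 : ℝ) else 0) ≤
      (if z ∈ {z : Fin n → Bit | a < noiseProb ε z} then noiseProb ε z else 0) +
        a * (if A w z then 1 else 0) := by
    intro w z
    have := noiseProb_nonneg hε z
    by_cases hA : A w z <;> by_cases hz : a < noiseProb ε z <;>
      simp only [hA, hz, Set.mem_ofPred_eq, if_true, if_false] <;> linarith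
  refine (Finset.sum_le_sum fun w _ => Finset.sum_le_sum fun z _ => h1 w z).trans ?_
  simp_rw [Finset.sum_add_distrib, ← Finset.mul_sum]
  refine add_le_add (by simp [noiseMeas]) ?_
  rw [mul_comm]
  refine mul_le_mul_of_nonneg_right ?_ ha
  have hsum : ∑ w, ∑ z, (if A w z then (1 : ℝ) else 0) =
      ((Finset.univ.filter fun x : W × (Fin n → Bit) => A x.1 x.2).card : ℝ) := by
    rw [← Fintype.sum_prod_type' (fun w z => if A w z then (1 : ℝ) else 0), Finset.sum_boole]
  rw [hsum]
  have hcard := Finset.card_le_card_of_injOn (s := Finset.univ.filter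
    fun x : W × (Fin n → Bit) => A x.1 x.2) (t := Finset.univ) (fun x => f x.1 x.2)
    (fun _ _ => Finset.mem_coe.2 (Finset.mem_univ _)) (fun x hx y hy hxy => by
      simp only [Finset.coe_filter, Finset.mem_univ, true_and, Set.mem_ofPred_eq] at hx hy
      obtain ⟨h, h'⟩ := hf _ _ _ _ hx hy hxy
      exact Prod.ext h h')
  rw [Finset.card_univ] at hcard
  have : Fintype.card (Fin n → Bit) = 2 ^ n := by simp
  rw [this] at hcard
  exact_mod_cast hcard

namespace Code

variable {W V : Type} {N : ℕ}

/-- The relay input is a function of `yR` alone, so `yR`, `z₁`, `z₂` fix what the terminals see,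
whatever the message. -/
theorem outputs_terminals_eq (c : Code W V N) {w w' : W} {v : V} {n : ℕ} {zR zR' z₁ z₂ : Fin n → Bit}
    (h : (c.outputs w v n (zipNoise zR z₁ z₂)).yR = (c.outputs w' v n (zipNoise zR' z₁ z₂)).yR) :
    (c.outputs w v n (zipNoise zR z₁ z₂)).y₁ = (c.outputs w' v n (zipNoise zR' z₁ z₂)).y₁ ∧
      (c.outputs w v n (zipNoise zR z₁ z₂)).y₂ = (c.outputs w' v n (zipNoise zR' z₁ z₂)).y₂ := by
  constructor <;> funext t
  · rw [(c.outputs_apply w v _ t).2.1, (c.outputs_apply w' v _ t).2.1]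
    simp only [Outputs.restrict, h, zipNoise]
  · rw [(c.outputs_apply w v _ t).2.2, (c.outputs_apply w' v _ t).2.2]
    simp only [Outputs.restrict, h, zipNoise]

theorem relayNoise_eq (c : Code W V N) {w : W} {v : V} {n : ℕ} {zR zR' z₁ z₂ : Fin n → Bit}
    (h : (c.outputs w v n (zipNoise zR z₁ z₂)).yR = (c.outputs w v n (zipNoise zR' z₁ z₂)).yR) :
    zR = zR' := by
  obtain ⟨e₁, e₂⟩ := c.outputs_terminals_eq h
  funext t
  have ht := congrFun h t
  rw [(c.outputs_apply w v _ t).1, (c.outputs_apply w v _ t).1] at ht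
  simp only [Outputs.restrict, e₁, e₂, zipNoise] at ht
  exact add_left_cancel ht

theorem terminalNoise_eq (c : Code W V N) {w : W} {v : V} {n : ℕ} {zR z₁ z₂ z₂' : Fin n → Bit}
    (h : (c.outputs w v n (zipNoise zR z₁ z₂)).y₂ = (c.outputs w v n (zipNoise zR z₁ z₂')).y₂) :
    z₂ = z₂' := by
  -- With `y₂` given, the relay and terminal 1 can be simulated forward in time without knowing the
  -- noise at terminal 2.
  have key : ∀ m (hm : m < n),
      (c.outputs w v n (zipNoise zR z₁ z₂)).yR ⟨m, hm⟩ =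
        (c.outputs w v n (zipNoise zR z₁ z₂')).yR ⟨m, hm⟩ ∧
      (c.outputs w v n (zipNoise zR z₁ z₂)).y₁ ⟨m, hm⟩ =
        (c.outputs w v n (zipNoise zR z₁ z₂')).y₁ ⟨m, hm⟩ := by
    intro m
    induction m using Nat.strong_induction_on with
    | _ m ih =>
      intro hm
      have hR : ∀ s : Fin m, (c.outputs w v n (zipNoise zR z₁ z₂)).yR (Fin.castLE hm.le s) =
          (c.outputs w v n (zipNoise zR z₁ z₂')).yR (Fin.castLE hm.le s) :=
        fun s => (ih s s.2 _).1
      have h₁ : ∀ s : Fin m, (c.outputs w v n (zipNoise zR z₁ z₂)).y₁ (Fin.castLE hm.le s) =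
          (c.outputs w v n (zipNoise zR z₁ z₂')).y₁ (Fin.castLE hm.le s) :=
        fun s => (ih s s.2 _).2
      constructor
      · rw [(c.outputs_apply w v _ ⟨m, hm⟩).1, (c.outputs_apply w v _ ⟨m, hm⟩).1]
        simp only [Outputs.restrict, h₁, h, zipNoise]
      · rw [(c.outputs_apply w v _ ⟨m, hm⟩).2.1, (c.outputs_apply w v _ ⟨m, hm⟩).2.1]
        simp only [Outputs.restrict, hR, zipNoise]
  have hR : (c.outputs w v n (zipNoise zR z₁ z₂)).yR =
      (c.outputs w v n (zipNoise zR z₁ z₂')).yR := funext fun t => (key t t.2).1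
  funext t
  have ht := congrFun h t
  rw [(c.outputs_apply w v _ t).2.2, (c.outputs_apply w v _ t).2.2] at ht
  simp only [Outputs.restrict, hR, zipNoise] at ht
  exact add_left_cancel ht

variable [Fintype W] [Fintype V]

theorem prob_add_prob_not (εR ε₁ ε₂ : ℝ) (c : Code W V N) [Nonempty W] [Nonempty V]
    (E : W → V → Outputs N → Prop) :
    c.prob εR ε₁ ε₂ E + c.prob εR ε₁ ε₂ (fun w v o => ¬ E w v o) = 1 := by
  classical
  rw [prob_eq, prob_eq, ← add_div, div_eq_one_iff_eq (by positivity)]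
  simp_rw [← Finset.sum_add_distrib, ← mul_add]
  have h1 : ∀ P : Prop, (if P then (1 : ℝ) else 0) + (if ¬P then 1 else 0) = 1 := fun P => by
    by_cases h : P <;> simp [h]
  simp_rw [h1, mul_one, ← Finset.mul_sum, sum_noiseProb, mul_one, ← Finset.mul_sum, sum_noiseProb,
    mul_one, sum_noiseProb]
  simp

theorem one_sub_err₂ (εR ε₁ ε₂ : ℝ) (c : Code W V N) [Nonempty W] [Nonempty V] :
    1 - c.err₂ εR ε₁ ε₂ = c.prob εR ε₁ ε₂ (fun w v o => c.dec₂ o.y₂ v = w) := by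
  rw [err₂, ← c.prob_add_prob_not εR ε₁ ε₂ fun w v o => c.dec₂ o.y₂ v = w]
  simp

theorem sum_noise_le_of_forall {ε ε' : ℝ} (hε : ε ∈ Set.Icc (0 : ℝ) 1)
    (hε' : ε' ∈ Set.Icc (0 : ℝ) 1) (f : (Fin N → Bit) → (Fin N → Bit) → ℝ) {K : ℝ}
    (h : ∀ a b, f a b ≤ K) :
    ∑ a : Fin N → Bit, ∑ b : Fin N → Bit, noiseProb ε a * noiseProb ε' b * f a b ≤ K := by
  calc ∑ a : Fin N → Bit, ∑ b : Fin N → Bit, noiseProb ε a * noiseProb ε' b * f a b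
      ≤ ∑ a : Fin N → Bit, ∑ b : Fin N → Bit, noiseProb ε a * noiseProb ε' b * K :=
        Finset.sum_le_sum fun a _ => Finset.sum_le_sum fun b _ =>
          mul_le_mul_of_nonneg_left (h a b)
            (mul_nonneg (noiseProb_nonneg hε a) (noiseProb_nonneg hε' b))
    _ = K := by
        simp_rw [← Finset.sum_mul, ← Finset.mul_sum, sum_noiseProb, mul_one, sum_noiseProb, one_mul]

/-- The counting bound for fixed `v`, `z₁`, `z₂`: `yR` yields `y₂`, a correct decoder then yields
the message, and the inputs reconstructed from it reveal `zR`. -/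
theorem one_sub_err₂_le_uplink {εR ε₁ ε₂ : ℝ} (hR : εR ∈ Set.Icc (0 : ℝ) 1)
    (h₁ : ε₁ ∈ Set.Icc (0 : ℝ) 1) (h₂ : ε₂ ∈ Set.Icc (0 : ℝ) 1) (c : Code W V N) [Nonempty W]
    [Nonempty V] {a : ℝ} (ha : 0 ≤ a) :
    1 - c.err₂ εR ε₁ ε₂ ≤
      noiseMeas εR {z : Fin N → Bit | a < noiseProb εR z} + 2 ^ N * a / Fintype.card W := by
  classical
  rw [one_sub_err₂, prob_eq, div_le_iff₀ (by positivity)]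
  set K : ℝ := Fintype.card W * noiseMeas εR {z : Fin N → Bit | a < noiseProb εR z} + 2 ^ N * a
    with hK
  calc _ = ∑ v : V, ∑ z₁ : Fin N → Bit, ∑ z₂ : Fin N → Bit, noiseProb ε₁ z₁ * noiseProb ε₂ z₂ *
        ∑ w : W, ∑ zR : Fin N → Bit, noiseProb εR zR *
          (if c.dec₂ (c.outputs w v N (zipNoise zR z₁ z₂)).y₂ v = w then (1 : ℝ) else 0) := by
        rw [Finset.sum_comm]
        refine Finset.sum_congr rfl fun v _ => ?_
        rw [← Fintype.sum_prod_type' fun (w : W) (zR : Fin N → Bit) =>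
          ∑ z₁, ∑ z₂, noiseProb εR zR * noiseProb ε₁ z₁ * noiseProb ε₂ z₂ *
            (if c.dec₂ (c.outputs w v N (zipNoise zR z₁ z₂)).y₂ v = w then (1 : ℝ) else 0),
          Finset.sum_comm]
        refine Finset.sum_congr rfl fun z₁ _ => ?_
        rw [Finset.sum_comm]
        refine Finset.sum_congr rfl fun z₂ _ => ?_
        rw [Fintype.sum_prod_type]
        simp_rw [Finset.mul_sum]
        refine Finset.sum_congr rfl fun w _ => Finset.sum_congr rfl fun zR _ => ?_
        ring
    _ ≤ ∑ _v : V, K := Finset.sum_le_sum fun v _ => sum_noise_le_of_forall h₁ h₂ _ fun z₁ z₂ => by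
        refine sum_noiseProb_le_of_injOn hR _
          (fun w zR => (c.outputs w v N (zipNoise zR z₁ z₂)).yR) ?_ ha
        intro w zR w' zR' hA hA' h
        have e := (c.outputs_terminals_eq h).2
        have hw : w = w' := by rw [← hA, ← hA', e]
        subst hw
        exact ⟨rfl, c.relayNoise_eq h⟩
    _ = _ := by
        rw [Finset.sum_const, Finset.card_univ, nsmul_eq_mul, hK]
        field_simp

/-- The counting bound for fixed `v`, `zR`, `z₁`: a correct decoder gets the message from `y₂`,
after which `terminalNoise_eq` recovers `z₂`. -/
theorem one_sub_err₂_le_downlink {εR ε₁ ε₂ : ℝ} (hR : εR ∈ Set.Icc (0 : ℝ) 1)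
    (h₁ : ε₁ ∈ Set.Icc (0 : ℝ) 1) (h₂ : ε₂ ∈ Set.Icc (0 : ℝ) 1) (c : Code W V N) [Nonempty W]
    [Nonempty V] {a : ℝ} (ha : 0 ≤ a) :
    1 - c.err₂ εR ε₁ ε₂ ≤
      noiseMeas ε₂ {z : Fin N → Bit | a < noiseProb ε₂ z} + 2 ^ N * a / Fintype.card W := by
  classical
  rw [one_sub_err₂, prob_eq, div_le_iff₀ (by positivity)]
  set K : ℝ := Fintype.card W * noiseMeas ε₂ {z : Fin N → Bit | a < noiseProb ε₂ z} + 2 ^ N * a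
    with hK
  calc _ = ∑ v : V, ∑ zR : Fin N → Bit, ∑ z₁ : Fin N → Bit, noiseProb εR zR * noiseProb ε₁ z₁ *
        ∑ w : W, ∑ z₂ : Fin N → Bit, noiseProb ε₂ z₂ *
          (if c.dec₂ (c.outputs w v N (zipNoise zR z₁ z₂)).y₂ v = w then (1 : ℝ) else 0) := by
        rw [Finset.sum_comm]
        refine Finset.sum_congr rfl fun v _ => ?_
        rw [Finset.sum_comm]
        refine Finset.sum_congr rfl fun zR _ => ?_
        rw [Finset.sum_comm]
        refine Finset.sum_congr rfl fun z₁ _ => ?_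
        simp_rw [Finset.mul_sum, mul_assoc]
    _ ≤ ∑ _v : V, K := Finset.sum_le_sum fun v _ => sum_noise_le_of_forall hR h₁ _ fun zR z₁ => by
        refine sum_noiseProb_le_of_injOn h₂ _
          (fun w z₂ => (c.outputs w v N (zipNoise zR z₁ z₂)).y₂) ?_ ha
        intro w z₂ w' z₂' hA hA' h
        have hw : w = w' := by rw [← hA, ← hA', h]
        subst hw
        exact ⟨rfl, c.terminalNoise_eq h⟩
    _ = _ := by
        rw [Finset.sum_const, Finset.card_univ, nsmul_eq_mul, hK]
        field_simp

end Code

theorem rate_le_one_sub_binEntropy₂ {ε εR ε₁ ε₂ R₁₂ R₂₁ : ℝ} (hε : ε ∈ Set.Icc (0 : ℝ) 1)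
    (hbound : ∀ (N M M' : ℕ) (c : Code (Fin M) (Fin M') N) (a : ℝ), 0 < M → 0 < M' → 0 ≤ a →
      1 - c.err₂ εR ε₁ ε₂ ≤
        noiseMeas ε {z : Fin N → Bit | a < noiseProb ε z} + 2 ^ N * a / M)
    (h : Achievable εR ε₁ ε₂ R₁₂ R₂₁) : R₁₂ ≤ 1 - binEntropy₂ ε := by
  by_contra! hlt
  set g : ℝ := R₁₂ - (1 - binEntropy₂ ε) with hg
  have hg0 : 0 < g := by linarith
  have hl2 : 0 < Real.log 2 := Real.log_pos one_lt_two
  -- Of the excess exponent `g * log 2`, a quarter goes to `δ` and a quarter to `η`, so the quotient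
  -- term still decays. The success probability is then at least 3/4 but below 1/4 + 1/4.
  set δ : ℝ := min (g / 4) (1 / 4) with hδ
  have hδ0 : 0 < δ := by positivity
  have hδg : δ ≤ g / 4 := min_le_left _ _
  have hδ1 : δ ≤ 1 / 4 := min_le_right _ _
  set η : ℝ := g * Real.log 2 / 4 with hη
  have hη0 : 0 < η := by positivity
  have hexp : Tendsto (fun N : ℕ => Real.exp (N * -(g * Real.log 2 / 2))) atTop (nhds 0) := by
    refine Real.tendsto_exp_atBot.comp ?_
    exact (tendsto_natCast_atTop_atTop (R := ℝ)).atTop_mul_const_of_neg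
      (by have : 0 < g * Real.log 2 / 2 := by positivity
          linarith)
  obtain ⟨N, hc, ht, he, hN⟩ := ((h δ hδ0).and (((tendsto_noiseMeas_gt hε hη0).eventually
    (gt_mem_nhds (show (0 : ℝ) < 1 / 4 by norm_num))).and ((hexp.eventually
    (gt_mem_nhds (show (0 : ℝ) < 1 / 4 by norm_num))).and (eventually_gt_atTop 0)))).exists
  obtain ⟨M, M', hM, hM', c, hr, -, -, herr⟩ := hc
  have hN0 : (0 : ℝ) < N := by exact_mod_cast hN
  have hM0 : (0 : ℝ) < M := by exact_mod_cast hM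
  have hb := hbound N M M' c (Real.exp (-(N * (Real.binEntropy ε - η)))) hM hM' (Real.exp_pos _).le
  have hMlow : Real.exp (N * (R₁₂ - δ) * Real.log 2) ≤ M := by
    rw [Code.rate₁₂, Fintype.card_fin, le_div_iff₀ hN0, Real.logb, le_div_iff₀ hl2] at hr
    rw [← Real.le_log_iff_exp_le hM0]
    linarith
  have hquot : 2 ^ N * Real.exp (-(N * (Real.binEntropy ε - η))) / M ≤
      Real.exp (N * -(g * Real.log 2 / 2)) := by
    rw [div_le_iff₀ hM0]
    refine le_trans ?_ (mul_le_mul_of_nonneg_left hMlow (Real.exp_pos _).le)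
    have hpow : (2 : ℝ) ^ N = Real.exp (N * Real.log 2) := by
      rw [Real.exp_nat_mul, Real.exp_log two_pos]
    rw [hpow, ← Real.exp_add, ← Real.exp_add, Real.exp_le_exp]
    have h1 := log_two_mul_one_sub_binEntropy₂ ε
    have h2 : Real.log 2 - Real.binEntropy ε + η ≤
        -(g * Real.log 2 / 2) + (R₁₂ - δ) * Real.log 2 := by
      have h3 := mul_le_mul_of_nonneg_right hδg hl2.le
      rw [← h1, hη]
      have h4 : R₁₂ * Real.log 2 = g * Real.log 2 + Real.log 2 * (1 - binEntropy₂ ε) := by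
        rw [hg]; ring
      linarith
    have h5 := mul_le_mul_of_nonneg_left h2 hN0.le
    linarith
  linarith

theorem rate_le_rateBound {εR ε₁ ε₂ R₁₂ R₂₁ : ℝ} (hR : εR ∈ Set.Icc (0 : ℝ) 1)
    (h₁ : ε₁ ∈ Set.Icc (0 : ℝ) 1) (h₂ : ε₂ ∈ Set.Icc (0 : ℝ) 1)
    (h : Achievable εR ε₁ ε₂ R₁₂ R₂₁) : R₁₂ ≤ rateBound εR ε₂ := by
  refine le_min (rate_le_one_sub_binEntropy₂ hR ?_ h) (rate_le_one_sub_binEntropy₂ h₂ ?_ h)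
  · intro N M M' c a hM hM' ha
    have : Nonempty (Fin M) := ⟨⟨0, hM⟩⟩
    have : Nonempty (Fin M') := ⟨⟨0, hM'⟩⟩
    simpa using c.one_sub_err₂_le_uplink hR h₁ h₂ ha
  · intro N M M' c a hM hM' ha
    have : Nonempty (Fin M) := ⟨⟨0, hM⟩⟩
    have : Nonempty (Fin M') := ⟨⟨0, hM'⟩⟩
    simpa using c.one_sub_err₂_le_downlink hR h₁ h₂ ha

theorem capacityRegion_eq {εR ε₁ ε₂ : ℝ} (hR : εR ∈ Set.Icc (0 : ℝ) 1)
    (h₁ : ε₁ ∈ Set.Icc (0 : ℝ) 1) (h₂ : ε₂ ∈ Set.Icc (0 : ℝ) 1) :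
    capacityRegion εR ε₁ ε₂ = {R : ℝ × ℝ | (0 ≤ R.1 ∧ R.1 ≤ rateBound εR ε₂) ∧
      (0 ≤ R.2 ∧ R.2 ≤ rateBound εR ε₁)} := by
  ext ⟨R₁₂, R₂₁⟩
  constructor
  · rintro ⟨p₁₂, p₂₁, h⟩
    exact ⟨⟨p₁₂, rate_le_rateBound hR h₁ h₂ h⟩, p₂₁, rate_le_rateBound hR h₂ h₁ h.swap⟩
  · rintro ⟨⟨p₁₂, b₁₂⟩, p₂₁, b₂₁⟩
    refine ⟨p₁₂, p₂₁, ?_⟩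
    rcases le_total R₂₁ R₁₂ with hle | hle
    · exact (exists_timeSharingAchieves hR h₁ h₂ p₂₁ hle b₁₂ b₂₁).achievable
    · exact (exists_timeSharingAchieves hR h₂ h₁ p₁₂ hle b₂₁ b₁₂).achievable.swap

/-! ### The cut-set bound -/

theorem sum_bern_sub (ε : ℝ) (c : Bit) : ∑ y, bern ε (y - c) = 1 := by
  rw [← sum_bern ε]
  exact (Equiv.subRight c).sum_comp (bern ε)

theorem sum_negMulLog_mul_bern (ε a : ℝ) (c : Bit) :
    ∑ y, Real.negMulLog (a * bern ε (y - c)) = Real.negMulLog a + a * Real.binEntropy ε := by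
  have h := (Equiv.subRight c).sum_comp fun b => Real.negMulLog (a * bern ε b)
  simp only [Equiv.subRight_apply] at h
  rw [h, sum_bit, bern_zero, bern_one, Real.negMulLog_mul, Real.negMulLog_mul,
    Real.binEntropy_eq_negMulLog_add_negMulLog_one_sub]
  ring

theorem negMulLog_half : Real.negMulLog (1 / 2) = 1 / 2 * Real.log 2 := by
  rw [Real.negMulLog, one_div, Real.log_inv]; ring

/-- Concavity at the midpoint: splitting a mass in two adds at most one bit per unit of mass. The
unnormalized form is what conditioning requires. -/
theorem negMulLog_add_le {a b : ℝ} (ha : 0 ≤ a) (hb : 0 ≤ b) :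
    Real.negMulLog a + Real.negMulLog b ≤ Real.negMulLog (a + b) + (a + b) * Real.log 2 := by
  have h := Real.concaveOn_negMulLog.2 (Set.mem_Ici.2 ha) (Set.mem_Ici.2 hb)
    (show (0 : ℝ) ≤ 1 / 2 by norm_num) (show (0 : ℝ) ≤ 1 / 2 by norm_num) (by norm_num)
  rw [smul_eq_mul, smul_eq_mul, smul_eq_mul, smul_eq_mul,
    show 1 / 2 * a + 1 / 2 * b = (a + b) * (1 / 2) by ring, Real.negMulLog_mul,
    negMulLog_half] at h
  linarith

theorem mutualInfo_downlinkLaw (ε : ℝ) {q : Bit → ℝ} (hq : ∑ x, q x = 1) :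
    mutualInfo (downlinkLaw ε q) =
      (∑ y, Real.negMulLog (∑ x, q x * bern ε (y - x))) / Real.log 2 - binEntropy₂ ε := by
  have h1 : ∀ x, ∑ y, q x * bern ε (y - x) = q x := fun x => by
    rw [← Finset.mul_sum, sum_bern_sub, mul_one]
  simp only [mutualInfo, entropy, downlinkLaw, Fintype.sum_prod_type, h1,
    sum_negMulLog_mul_bern, Finset.sum_add_distrib, ← Finset.sum_mul, hq, binEntropy₂]
  ring

/-- This is H(Y_R | X₂₁) - H(Z_R): given both inputs, the only uncertainty left in the output is the
noise. -/
theorem condMutualInfo_uplinkLaw (ε : ℝ) {p : Bit × Bit → ℝ} (hp : ∑ x, p x = 1) :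
    condMutualInfo (uplinkLaw ε p) =
      (∑ x₂, (∑ y, Real.negMulLog (∑ x₁, p (x₁, x₂) * bern ε (y - x₁ - x₂)) -
        Real.negMulLog (∑ x₁, p (x₁, x₂)))) / Real.log 2 - binEntropy₂ ε := by
  have h1 : ∀ x₁ x₂, ∑ y, p (x₁, x₂) * bern ε (y - x₁ - x₂) = p (x₁, x₂) := fun x₁ x₂ => by
    simp_rw [← Finset.mul_sum, sub_sub, sum_bern_sub, mul_one]
  have h2 : ∀ x₁ x₂, ∑ y, Real.negMulLog (p (x₁, x₂) * bern ε (y - x₁ - x₂)) =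
      Real.negMulLog (p (x₁, x₂)) + p (x₁, x₂) * Real.binEntropy ε := fun x₁ x₂ => by
    simp_rw [sub_sub, sum_negMulLog_mul_bern]
  have h3 : ∑ x₁, ∑ y, ∑ x₂, Real.negMulLog (p (x₁, x₂) * bern ε (y - x₁ - x₂)) =
      ∑ x₁, ∑ x₂, Real.negMulLog (p (x₁, x₂)) + Real.binEntropy ε := by
    rw [Fintype.sum_prod_type] at hp
    have : ∀ x₁, ∑ y, ∑ x₂, Real.negMulLog (p (x₁, x₂) * bern ε (y - x₁ - x₂)) =
        ∑ x₂, (Real.negMulLog (p (x₁, x₂)) + p (x₁, x₂) * Real.binEntropy ε) := fun x₁ => by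
      rw [Finset.sum_comm]
      exact Finset.sum_congr rfl fun x₂ _ => h2 x₁ x₂
    simp_rw [this, Finset.sum_add_distrib, ← Finset.sum_mul, hp, one_mul]
  have h4 : ∑ y, ∑ x₂, Real.negMulLog (∑ x₁, p (x₁, x₂) * bern ε (y - x₁ - x₂)) =
      ∑ x₂, ∑ y, Real.negMulLog (∑ x₁, p (x₁, x₂) * bern ε (y - x₁ - x₂)) := Finset.sum_comm
  simp only [condMutualInfo, entropy, uplinkLaw, Fintype.sum_prod_type, h1, h3, h4,
    Finset.sum_sub_distrib, binEntropy₂]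
  ring

theorem mutualInfo_downlinkLaw_le {ε : ℝ} (hε : ε ∈ Set.Icc (0 : ℝ) 1) {q : Bit → ℝ}
    (hq : q ∈ stdSimplex ℝ Bit) : mutualInfo (downlinkLaw ε q) ≤ 1 - binEntropy₂ ε := by
  rw [mutualInfo_downlinkLaw ε hq.2]
  refine sub_le_sub_right ((div_le_one (Real.log_pos one_lt_two)).2 ?_) _
  have hnn : ∀ y, 0 ≤ ∑ x, q x * bern ε (y - x) := fun y =>
    Finset.sum_nonneg fun x _ => mul_nonneg (hq.1 x) (bern_nonneg hε _)
  have hsum : ∑ y, ∑ x, q x * bern ε (y - x) = 1 := by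
    rw [Finset.sum_comm]
    simp_rw [← Finset.mul_sum, sum_bern_sub, mul_one]
    exact hq.2
  have h := negMulLog_add_le (hnn 0) (hnn 1)
  rw [sum_bit] at hsum
  rw [hsum, Real.negMulLog_one, zero_add, one_mul] at h
  rwa [sum_bit]

theorem condMutualInfo_uplinkLaw_le {ε : ℝ} (hε : ε ∈ Set.Icc (0 : ℝ) 1) {p : Bit × Bit → ℝ}
    (hp : p ∈ stdSimplex ℝ (Bit × Bit)) :
    condMutualInfo (uplinkLaw ε p) ≤ 1 - binEntropy₂ ε := by
  rw [condMutualInfo_uplinkLaw ε hp.2]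
  refine sub_le_sub_right ((div_le_one (Real.log_pos one_lt_two)).2 ?_) _
  have hnn : ∀ x₂ y, 0 ≤ ∑ x₁, p (x₁, x₂) * bern ε (y - x₁ - x₂) := fun x₂ y =>
    Finset.sum_nonneg fun x₁ _ => mul_nonneg (hp.1 _) (bern_nonneg hε _)
  have hsum : ∀ x₂, ∑ y, ∑ x₁, p (x₁, x₂) * bern ε (y - x₁ - x₂) = ∑ x₁, p (x₁, x₂) := by
    intro x₂
    rw [Finset.sum_comm]
    simp_rw [← Finset.mul_sum, sub_sub, sum_bern_sub, mul_one]
  calc ∑ x₂, (∑ y, Real.negMulLog (∑ x₁, p (x₁, x₂) * bern ε (y - x₁ - x₂)) -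
        Real.negMulLog (∑ x₁, p (x₁, x₂)))
      ≤ ∑ x₂, (∑ x₁, p (x₁, x₂)) * Real.log 2 := Finset.sum_le_sum fun x₂ _ => by
        have h := negMulLog_add_le (hnn x₂ 0) (hnn x₂ 1)
        have hs := hsum x₂
        rw [sum_bit] at hs
        rw [hs] at h
        rw [sum_bit]
        linarith
    _ = Real.log 2 := by
        have := hp.2
        rw [Fintype.sum_prod_type_right] at this
        rw [← Finset.sum_mul, this, one_mul]

theorem sum_bern_sub_left (ε : ℝ) (y : Bit) : ∑ x, bern ε (y - x) = 1 := by
  rw [← sum_bern ε]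
  exact (Equiv.subLeft y).sum_comp (bern ε)

theorem mutualInfo_downlinkLaw_uniform (ε : ℝ) :
    mutualInfo (downlinkLaw ε fun _ => 1 / 2) = 1 - binEntropy₂ ε := by
  have hl : Real.log 2 ≠ 0 := (Real.log_pos one_lt_two).ne'
  rw [mutualInfo_downlinkLaw ε (by rw [sum_bit]; norm_num)]
  simp_rw [← Finset.mul_sum, sum_bern_sub_left, mul_one, negMulLog_half, sum_bit]
  field_simp
  ring

theorem condMutualInfo_uplinkLaw_uniform (ε : ℝ) :
    condMutualInfo (uplinkLaw ε fun _ => 1 / 4) = 1 - binEntropy₂ ε := by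
  have hl : Real.log 2 ≠ 0 := (Real.log_pos one_lt_two).ne'
  have hsum : ∀ x₂ y : Bit, ∑ x₁, bern ε (y - x₁ - x₂) = 1 := fun x₂ y => by
    simp_rw [sub_right_comm y _ x₂, sum_bern_sub_left]
  have h4 : Real.negMulLog (1 / 4) = 1 / 2 * Real.log 2 := by
    rw [show (1 / 4 : ℝ) = 1 / 2 * (1 / 2) by norm_num, Real.negMulLog_mul, negMulLog_half]
    ring
  rw [condMutualInfo_uplinkLaw ε (by rw [Fintype.sum_prod_type]; simp_rw [sum_bit]; norm_num)]
  simp_rw [← Finset.mul_sum, hsum, mul_one, h4, sum_bit]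
  rw [show (1 / 4 + 1 / 4 : ℝ) = 1 / 2 by norm_num, negMulLog_half]
  field_simp
  ring

theorem binEntropy₂_le_of_le {a b : ℝ} (ha : 0 ≤ a) (hab : a ≤ b) (hb : b ≤ 1 / 2) :
    binEntropy₂ a ≤ binEntropy₂ b := by
  rw [one_div] at hb
  exact div_le_div_of_nonneg_right (Real.binEntropy_strictMonoOn.monotoneOn
    ⟨ha, hab.trans hb⟩ ⟨ha.trans hab, hb⟩ hab) (Real.log_pos one_lt_two).le

end TWR

/-! ### Assembly of the five statements and the three relay regimes. -/

theorem mainTheorem3 (εR ε₁ ε₂ : ℝ)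
    (hR : εR ∈ Set.Icc (0 : ℝ) 1) (h₁ : ε₁ ∈ Set.Icc (0 : ℝ) 1) (h₂ : ε₂ ∈ Set.Icc (0 : ℝ) 1) :
    -- the cut-set bound, with equality for uniform inputs
    ((∀ p ∈ stdSimplex ℝ (TWR.Bit × TWR.Bit), ∀ q ∈ stdSimplex ℝ TWR.Bit,
        TWR.cutSet₁₂ εR ε₂ p q ≤ TWR.rateBound εR ε₂ ∧
        TWR.cutSet₂₁ εR ε₁ p q ≤ TWR.rateBound εR ε₁) ∧
      TWR.cutSet₁₂ εR ε₂ (fun _ => 1 / 4) (fun _ => 1 / 2) = TWR.rateBound εR ε₂ ∧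
      TWR.cutSet₂₁ εR ε₁ (fun _ => 1 / 4) (fun _ => 1 / 2) = TWR.rateBound εR ε₁) ∧
    -- the capacity region
    TWR.capacityRegion εR ε₁ ε₂ =
      {R : ℝ × ℝ | (0 ≤ R.1 ∧ R.1 ≤ TWR.rateBound εR ε₂) ∧
        (0 ≤ R.2 ∧ R.2 ≤ TWR.rateBound εR ε₁)} ∧
    -- what time-sharing with a given fraction achieves
    (∀ α R₁₂ R₂₁ : ℝ, 0 ≤ α → α ≤ 1 → 0 ≤ R₂₁ → R₂₁ ≤ R₁₂ →
      R₁₂ - R₂₁ ≤ (1 - α) * (1 - TWR.binEntropy₂ εR) →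
      R₂₁ ≤ α * (1 - TWR.binEntropy₂ εR) →
      R₂₁ ≤ 1 - TWR.binEntropy₂ ε₁ →
      R₁₂ ≤ 1 - TWR.binEntropy₂ ε₂ →
      TWR.TimeSharingAchieves εR ε₁ ε₂ α R₁₂ R₂₁) ∧
    -- every point of the region is achieved by time-sharing, the terminal with the larger rate
    -- using the private codebook
    (∀ R₁₂ R₂₁ : ℝ, 0 ≤ R₁₂ → R₁₂ ≤ TWR.rateBound εR ε₂ →
      0 ≤ R₂₁ → R₂₁ ≤ TWR.rateBound εR ε₁ →
      (R₂₁ ≤ R₁₂ → ∃ α : ℝ, TWR.TimeSharingAchieves εR ε₁ ε₂ α R₁₂ R₂₁) ∧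
      (R₁₂ ≤ R₂₁ → ∃ α : ℝ, TWR.TimeSharingAchieves εR ε₂ ε₁ α R₂₁ R₁₂)) ∧
    -- the explicit fractions for the corner point
    (εR ≤ 1 / 2 → ε₁ ≤ 1 / 2 → ε₂ ≤ 1 / 2 →
      -- strong relay
      (max ε₁ ε₂ ≤ εR →
        TWR.rateBound εR ε₂ = 1 - TWR.binEntropy₂ εR ∧
        TWR.rateBound εR ε₁ = 1 - TWR.binEntropy₂ εR ∧
        TWR.TimeSharingAchieves εR ε₁ ε₂ 1
          (1 - TWR.binEntropy₂ εR) (1 - TWR.binEntropy₂ εR)) ∧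
      -- medium relay
      (εR ≤ ε₁ → ε₂ ≤ εR →
        TWR.rateBound εR ε₂ = 1 - TWR.binEntropy₂ εR ∧
        TWR.rateBound εR ε₁ = 1 - TWR.binEntropy₂ ε₁ ∧
        TWR.TimeSharingAchieves εR ε₁ ε₂
          ((1 - TWR.binEntropy₂ ε₁) / (1 - TWR.binEntropy₂ εR))
          (1 - TWR.binEntropy₂ εR) (1 - TWR.binEntropy₂ ε₁)) ∧
      -- weak relay
      (ε₂ ≤ ε₁ → εR ≤ ε₂ →
        TWR.rateBound εR ε₂ = 1 - TWR.binEntropy₂ ε₂ ∧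
        TWR.rateBound εR ε₁ = 1 - TWR.binEntropy₂ ε₁ ∧
        TWR.TimeSharingAchieves εR ε₁ ε₂
          ((1 - TWR.binEntropy₂ ε₁) / (1 - TWR.binEntropy₂ ε₂))
          (1 - TWR.binEntropy₂ ε₂) (1 - TWR.binEntropy₂ ε₁))) := by
  refine ⟨⟨fun p hp q hq => ?_, ?_, ?_⟩, TWR.capacityRegion_eq hR h₁ h₂,
    fun α R₁₂ R₂₁ a0 a1 r0 rr hP hC hd₁ hd₂ =>
      TWR.timeSharingAchieves hR h₁ h₂ a0 a1 r0 rr hP hC hd₁ hd₂,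
    fun R₁₂ R₂₁ p₁₂ b₁₂ p₂₁ b₂₁ => ⟨fun hle =>
      ⟨_, TWR.exists_timeSharingAchieves hR h₁ h₂ p₂₁ hle b₁₂ b₂₁⟩, fun hle =>
      ⟨_, TWR.exists_timeSharingAchieves hR h₂ h₁ p₁₂ hle b₂₁ b₁₂⟩⟩,
    fun sR s₁ s₂ => ⟨fun hmax => ?_, fun hR1 h2R => ?_, fun h21 hR2 => ?_⟩⟩
  · have hp' : (fun x : TWR.Bit × TWR.Bit => p (x.2, x.1)) ∈ stdSimplex ℝ (TWR.Bit × TWR.Bit) :=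
      ⟨fun x => hp.1 _, ((Equiv.prodComm _ _).sum_comp p).trans hp.2⟩
    exact ⟨min_le_min (TWR.condMutualInfo_uplinkLaw_le hR hp) (TWR.mutualInfo_downlinkLaw_le h₂ hq),
      min_le_min (TWR.condMutualInfo_uplinkLaw_le hR hp') (TWR.mutualInfo_downlinkLaw_le h₁ hq)⟩
  · exact congrArg₂ min (TWR.condMutualInfo_uplinkLaw_uniform εR)
      (TWR.mutualInfo_downlinkLaw_uniform ε₂)
  · exact congrArg₂ min (TWR.condMutualInfo_uplinkLaw_uniform εR)
      (TWR.mutualInfo_downlinkLaw_uniform ε₁)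
  · have m₁ := TWR.binEntropy₂_le_of_le h₁.1 ((le_max_left _ _).trans hmax) sR
    have m₂ := TWR.binEntropy₂_le_of_le h₂.1 ((le_max_right _ _).trans hmax) sR
    have hC := TWR.binEntropy₂_le_one εR
    exact ⟨min_eq_left (by linarith), min_eq_left (by linarith),
      TWR.timeSharingAchieves hR h₁ h₂ zero_le_one le_rfl (by linarith) le_rfl (by linarith)
        (by linarith) (by linarith) (by linarith)⟩
  · have m₁ := TWR.binEntropy₂_le_of_le hR.1 hR1 s₁
    have m₂ := TWR.binEntropy₂_le_of_le h₂.1 h2R sR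
    have hC := TWR.binEntropy₂_le_one ε₁
    have e₁₂ : TWR.rateBound εR ε₂ = 1 - TWR.binEntropy₂ εR := min_eq_left (by linarith)
    have e₂₁ : TWR.rateBound εR ε₁ = 1 - TWR.binEntropy₂ ε₁ := min_eq_right (by linarith)
    exact ⟨e₁₂, e₂₁, TWR.exists_timeSharingAchieves hR h₁ h₂ (by linarith) (by linarith)
      e₁₂.ge e₂₁.ge⟩
  · have m₁ := TWR.binEntropy₂_le_of_le h₂.1 h21 s₁
    have m₂ := TWR.binEntropy₂_le_of_le hR.1 hR2 s₂
    have hC₁ := sub_nonneg.2 (TWR.binEntropy₂_le_one ε₁)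
    have hC₂ := sub_nonneg.2 (TWR.binEntropy₂_le_one ε₂)
    have hα1 : (1 - TWR.binEntropy₂ ε₁) / (1 - TWR.binEntropy₂ ε₂) ≤ 1 :=
      div_le_one_of_le₀ (by linarith) hC₂
    have hα0 := div_nonneg hC₁ hC₂
    have hmul : (1 - TWR.binEntropy₂ ε₁) / (1 - TWR.binEntropy₂ ε₂) * (1 - TWR.binEntropy₂ ε₂) =
        1 - TWR.binEntropy₂ ε₁ := by
      rcases hC₂.eq_or_lt with h | h
      · rw [← h, mul_zero]; linarith
      · field_simp
    -- This `α` splits 1 - H(ε₂), rather than the larger uplink capacity, in the ratio of common to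
    -- private rate. Both uplink constraints follow by enlarging 1 - H(ε₂) to 1 - H(ε_R).
    have hle : 1 - TWR.binEntropy₂ ε₂ ≤ 1 - TWR.binEntropy₂ εR := by linarith
    have q₁ := mul_le_mul_of_nonneg_left hle hα0
    have q₂ := mul_le_mul_of_nonneg_left hle (sub_nonneg.2 hα1)
    rw [sub_mul, hmul, one_mul] at q₂
    exact ⟨min_eq_right hle, min_eq_right (by linarith),
      TWR.timeSharingAchieves hR h₁ h₂ hα0 hα1 hC₁ (by linarith) (by linarith) (by linarith) le_rfl
        le_rfl⟩
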